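/- **Theorem (Semantic Soundness).** *The calculus.* Fix a transition system $\mathcal T$: sets $\mathsf{State}$, $\mathsf{Event}$ and sets $\mathsf{Step}(s,e,s')$ of transition witnesses. DEKL over $\mathcal T$ is the dependent type theory with judgments $\vdash\Gamma\ \mathsf{ctx}$, $\Gamma\vdash t:A$ and $\Gamma\vdash t\equiv u:A$ that are generated by the following rules, where $U$ ranges over the universes $\mathsf{Uc}_i$, $\mathsf{Type}_i$, and where $\equiv$ is a congruence (an equivalence relation compatible with all term and type formers): * context formation, variables, and conversion along $\Gamma\vdash A\equiv B:U$; * $\mathsf{Uc}_i:\mathsf{Uc}_{i+1}$, $\mathsf{Type}_i:\mathsf{Type}_{i+1}$, $\mathsf{Prop}:\mathsf{Type}_0$; * $\Pi$-types (if $A:U$ and $B:U$ over $x:A$, then $\Pi(x:A).B:U$), abstraction, application, $\beta$; likewise binary products with pairing, projections and their $\beta$-rules, and $\mathsf{Nat}:\mathsf{Uc}_0$ with zero, successor and dependent eliminator; * $\mathsf{State},\mathsf{Event},\mathsf{Step}(\sigma,e,\sigma'),\mathsf{FinTrace}(\sigma,\sigma'):\mathsf{Uc}_0$, with constants for the states,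 events and transitions of $\mathcal T$; the constructors $\mathsf{nil}(\sigma):\mathsf{FinTrace}(\sigma,\sigma)$ and $\mathsf{step}(\tau,e,\pi):\mathsf{FinTrace}(\sigma_0,\sigma_2)$ for $\tau:\mathsf{FinTrace}(\sigma_0,\sigma_1)$, $e:\mathsf{Event}$, $\pi:\mathsf{Step}(\sigma_1,e,\sigma_2)$; the dependent eliminator $\mathsf{trace\text{-}elim}$ into families $P(x,\tau):U$ ($x:\mathsf{State}$, $\tau:\mathsf{FinTrace}(\sigma_0,x)$) with its two computation rules at $\mathsf{nil}$ and $\mathsf{step}$; * $\mathsf{InfTrace}:\mathsf{Uc}_0$ with $\mathsf{head}:\mathsf{State}$, $\mathsf{tail}:\mathsf{Event}\times\mathsf{InfTrace}$, and the corecursor with its computation rules; * for $\tau:\mathsf{FinTrace}(\sigma_0,\sigma_1)$ and $\tau':\mathsf{FinTrace}(\sigma_0,\sigma_2)$, the type $\mathsf{Ext}(\tau,\tau'):\mathsf{Uc}_0$ of trace extensions, with $\mathrm{id}_\tau:\mathsf{Ext}(\tau,\tau)$, $\epsilon_1\circ\epsilon_2:\mathsf{Ext}(\tau,\tau'')$ for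 $\epsilon_1:\mathsf{Ext}(\tau,\tau')$, $\epsilon_2:\mathsf{Ext}(\tau',\tau'')$, and the one-step extension in $\mathsf{Ext}(\tau,\mathsf{step}(\tau,e,\pi))$; the knowledge family $K(\tau):\mathsf{Type}_\ell$ and $\mathsf{restrict}(\epsilon,k):K(\tau)$ for $\epsilon:\mathsf{Ext}(\tau,\tau')$, $k:K(\tau')$, with $\mathsf{restrict}(\mathrm{id}_\tau,k)\equiv k$ and $\mathsf{restrict}(\epsilon_1\circ\epsilon_2,k)\equiv\mathsf{restrict}(\epsilon_1,\mathsf{restrict}(\epsilon_2,k))$. For $N\in\mathbb N\cup\{\infty\}$ with $\ell\le N$ let $\mathrm{DEKL}_N$ be the part with universe levels at most $N$; DEKL is $\mathrm{DEKL}_\infty$. *The model.* Let $(\kappa_i)_{i\le N}$ and $(\mu_i)_{i\le N}$ be strictly increasing sequences of inaccessible cardinals such that $\mathsf{State}$, $\mathsf{Event}$ and all $\mathsf{Step}(s,e,s')$ have fewer than $\kappa_0$ and fewer than $\mu_0$ elements. Let $T_f$ be the category of finite traces of $\mathcal T$ and trace extensions, and $K_f:T_f^{op}\to\mathbf{Set}$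 a presheaf whose values have fewer than $\mu_\ell$ elements. Contexts are interpreted in the category with families (CwF) of sets and families of sets, with $[\![\cdot]\!]$ the empty (terminal) context and $[\![\Gamma,x:A]\!]$ the comprehension of $[\![A]\!]$ over $[\![\Gamma]\!]$; $[\![\mathsf{Uc}_i]\!]=V_{\kappa_i}$, $[\![\mathsf{Type}_i]\!]=V_{\mu_i}$; $\Pi$ is the set of dependent functions; $\mathsf{Prop}$ is the set of subobjects of the terminal presheaf on $T_f$; $\mathsf{FinTrace}(\sigma_0,\sigma_1)$ is the set of morphisms $[\![\sigma_0]\!]\to[\![\sigma_1]\!]$ of the free category on the transition graph of $\mathcal T$, and trace elimination is recursion on such morphisms; $\mathsf{InfTrace}$ is the set of sequences of pairs (state, event); $\mathsf{Ext}(\tau,\tau')$ is the set of morphisms of $T_f$; $K(\tau)$ is $K_f([\![\tau]\!])$, and $\mathsf{restrict}$ is the action of $K_f$ on morphisms. *Claim.* 1. If $\Gamma\vdash t:A$ is derivable in $\mathrm{DEKL}_N$, then $t$ has a (unique) interpretation $[\![t]\!]$ as a term of type $[\![A]\!]$ over $[\![\Gamma]\!]$ in the CwF. 2. If $\Gamma\vdash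 t\equiv t':A$ is derivable, in particular if it is an instance of a computation rule, then $[\![t]\!]=[\![t']\!]$ as terms of type $[\![A]\!]$; and if $\Gamma\vdash A\equiv B:U$ is derivable, then $[\![A]\!]=[\![B]\!]$ as types over $[\![\Gamma]\!]$. 3. Every derivable simultaneous substitution $\Delta\vdash\sigma:\Gamma$ has a unique interpretation $[\![\sigma]\!]:[\![\Delta]\!]\to[\![\Gamma]\!]$, and $[\![A[\sigma]]\!]=[\![A]\!][[\![\sigma]\!]]$ and $[\![t[\sigma]]\!]=[\![t]\!][[\![\sigma]\!]]$ for all derivable $\Gamma\vdash t:A$. Identities, composites and weakenings are interpreted by identities, composites and comprehension projections. In particular $[\![t[s/x]]\!]=[\![t]\!][\langle\mathrm{id},[\![s]\!]\rangle]$ for all derivable $\Gamma,x:A\vdash t:B$ and $\Gamma\vdash s:A$. 4. At every point of $[\![\Gamma]\!]$, a derivable $\tau:\mathsf{FinTrace}(\sigma_0,\sigma_1)$ denotes a morphism $[\![\sigma_0]\!]\to[\![\sigma_1]\!]$ of the free trace category, $\mathsf{nil}(\sigma)$ denotes the identity of $[\![\sigma]\!]$, $\mathsf{step}(\tau,e,\pi)$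 denotes $[\![\tau]\!]$ followed by the generating morphism $([\![e]\!],[\![\pi]\!])$, and, for derivable $\epsilon:\mathsf{Ext}(\tau,\tau')$ and $k:K(\tau')$, $\mathsf{restrict}(\epsilon,k)$ denotes $K_f([\![\epsilon]\!])([\![k]\!])\in K_f([\![\tau]\!])$. -/

import Mathlib

universe u v w w₁ w₂

open CategoryTheory Opposite Cardinal

namespace DEKL

/-! ## Categories with families -/

/-- A category with families: a category of contexts with a terminal object, types and terms in
context with a strictly functorial substitution action, and context comprehension. -/
structure CwF where
  Ctx : Type w
  [cat : Category.{v} Ctx]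
  empty : Ctx
  emptyIsTerminal : Limits.IsTerminal empty
  Ty : Ctx → Type w₁
  Tm : (Γ : Ctx) → Ty Γ → Type w₂
  tySub : {Δ Γ : Ctx} → (Δ ⟶ Γ) → Ty Γ → Ty Δ
  tmSub : {Δ Γ : Ctx} → (σ : Δ ⟶ Γ) → {A : Ty Γ} → Tm Γ A → Tm Δ (tySub σ A)
  tySub_id : ∀ {Γ : Ctx} (A : Ty Γ), tySub (𝟙 Γ) A = A
  tySub_comp : ∀ {Θ Δ Γ : Ctx} (τ : Θ ⟶ Δ) (σ : Δ ⟶ Γ) (A : Ty Γ),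
    tySub (τ ≫ σ) A = tySub τ (tySub σ A)
  tmSub_id : ∀ {Γ : Ctx} {A : Ty Γ} (a : Tm Γ A), tmSub (𝟙 Γ) a ≍ a
  tmSub_comp : ∀ {Θ Δ Γ : Ctx} (τ : Θ ⟶ Δ) (σ : Δ ⟶ Γ) {A : Ty Γ} (a : Tm Γ A),
    tmSub (τ ≫ σ) a ≍ tmSub τ (tmSub σ a)
  ext : (Γ : Ctx) → Ty Γ → Ctx
  p : {Γ : Ctx} → (A : Ty Γ) → (ext Γ A ⟶ Γ)
  q : {Γ : Ctx} → (A : Ty Γ) → Tm (ext Γ A) (tySub (p A) A)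
  pair : {Δ Γ : Ctx} → (σ : Δ ⟶ Γ) → {A : Ty Γ} → Tm Δ (tySub σ A) → (Δ ⟶ ext Γ A)
  pair_p : ∀ {Δ Γ : Ctx} (σ : Δ ⟶ Γ) {A : Ty Γ} (a : Tm Δ (tySub σ A)), pair σ a ≫ p A = σ
  pair_q : ∀ {Δ Γ : Ctx} (σ : Δ ⟶ Γ) {A : Ty Γ} (a : Tm Δ (tySub σ A)),
    tmSub (pair σ a) (q A) ≍ a
  pair_unique : ∀ {Δ Γ : Ctx} (σ : Δ ⟶ Γ) {A : Ty Γ} (a : Tm Δ (tySub σ A)) (θ : Δ ⟶ ext Γ A),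
    θ ≫ p A = σ → tmSub θ (q A) ≍ a → θ = pair σ a

attribute [instance] CwF.cat

/-- The set-theoretic category with families: contexts are (large) sets, a type over `Γ` is a
family of sets indexed by `Γ`, a term is a section of such a family, substitution is reindexing,
and comprehension is the total space of a family. -/
def setCwF : CwF.{u + 1, u + 2, u + 1, u + 1} where
  Ctx := Type (u + 1)
  empty := PUnit
  emptyIsTerminal := Limits.Types.isTerminalPUnit
  Ty Γ := Γ → ZFSet.{u}
  Tm Γ A := ∀ γ : Γ, {x : ZFSet.{u} // x ∈ A γ}
  tySub σ A := fun δ => A (σ δ)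
  tmSub σ _ a := fun δ => a (σ δ)
  tySub_id _ := rfl
  tySub_comp _ _ _ := rfl
  tmSub_id _ := HEq.rfl
  tmSub_comp _ _ _ _ := HEq.rfl
  ext Γ A := Σ γ : Γ, {x : ZFSet.{u} // x ∈ A γ}
  p _ := TypeCat.ofHom fun x => x.1
  q _ := fun x => x.2
  pair σ _ a := TypeCat.ofHom fun δ => ⟨σ δ, a δ⟩
  pair_p _ _ _ := rfl
  pair_q _ _ _ := HEq.rfl
  pair_unique := by
    rintro Δ Γ σ A a θ rfl h
    have h' := eq_of_heq h
    subst h'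
    rfl

/-- The function underlying a morphism of contexts of `setCwF`. -/
def setFun {Δ Γ : setCwF.{u}.Ctx} (f : Δ ⟶ Γ) : Δ → Γ :=
  (ConcreteCategory.hom (C := Type (u + 1)) (X := Δ) (Y := Γ) f).toFun

/-! ## Transition systems, the free trace category and the category of finite traces -/

/-- A transition system with proof-relevant one-step transitions. -/
structure TransitionSystem where
  State : Type u
  Event : Type u
  Step : State → Event → State → Type u

variable {𝒯 : TransitionSystem.{u}}

/-- The underlying transition graph: an edge `s ⟶ s'` is an event with a transition. -/
instance transitionGraph (𝒯 : TransitionSystem.{u}) : Quiver.{u} 𝒯.State where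
  Hom s s' := Σ e : 𝒯.Event, 𝒯.Step s e s'

/-- The free trace category: the free category on the transition graph. Objects are states,
morphisms are finite traces. -/
abbrev FreeTrace (𝒯 : TransitionSystem.{u}) : Type u := Paths 𝒯.State

/-- A single transition `src --ev--> tgt`, with its witness. -/
structure Transition (𝒯 : TransitionSystem.{u}) where
  src : 𝒯.State
  ev : 𝒯.Event
  tgt : 𝒯.State
  wit : 𝒯.Step src ev tgt

/-- A state as an object of the free trace category. -/
abbrev pt (s : 𝒯.State) : FreeTrace 𝒯 := (Paths.of 𝒯.State).obj s

/-- The generating morphism of the free trace category given by a transition. -/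
def gen {s s' : 𝒯.State} (e : 𝒯.Event) (π : 𝒯.Step s e s') : pt s ⟶ pt s' :=
  (Paths.of 𝒯.State).map (Sigma.mk e π : s ⟶ s')

/-- A finite trace: a morphism of the free trace category together with its end points. -/
structure Trace (𝒯 : TransitionSystem.{u}) where
  src : 𝒯.State
  tgt : 𝒯.State
  hom : pt src ⟶ pt tgt

/-- A trace extension `τ ⟶ τ'`: both traces start in the same state, and `τ'` is `τ` followed
by the trace `tail`. -/
@[ext]
structure TraceExt (τ τ' : Trace 𝒯) where
  src_eq : τ'.src = τ.src
  tail : pt τ.tgt ⟶ pt τ'.tgt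
  comp_eq : τ'.hom = eqToHom (congrArg pt src_eq) ≫ τ.hom ≫ tail

/-- The category `T_f` of finite traces and trace extensions. -/
instance traceCategory (𝒯 : TransitionSystem.{u}) : Category.{u} (Trace 𝒯) where
  Hom := TraceExt
  id τ := ⟨rfl, 𝟙 (pt τ.tgt), by simp⟩
  comp f g := ⟨g.src_eq.trans f.src_eq, f.tail ≫ g.tail, by
    rw [g.comp_eq, f.comp_eq]; simp⟩
  id_comp f := TraceExt.ext (Category.id_comp _)
  comp_id f := TraceExt.ext (Category.comp_id _)
  assoc f g h := TraceExt.ext (Category.assoc _ _ _)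

/-- The empty trace at a state. -/
def Trace.empty (s : 𝒯.State) : Trace 𝒯 := ⟨s, s, 𝟙 (pt s)⟩

/-- The trace `τ` followed by one more transition. -/
def Trace.snoc (τ : Trace 𝒯) (x : Transition 𝒯) (h : τ.tgt = x.src) : Trace 𝒯 :=
  ⟨τ.src, x.tgt, τ.hom ≫ eqToHom (congrArg pt h) ≫ gen x.ev x.wit⟩

/-- The one-step extension of `τ` by a transition. -/
def Trace.snocExt (τ : Trace 𝒯) (x : Transition 𝒯) (h : τ.tgt = x.src) : τ ⟶ τ.snoc x h :=
  TraceExt.mk (τ := τ) (τ' := τ.snoc x h) rfl (eqToHom (congrArg pt h) ≫ gen x.ev x.wit)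
    (Category.id_comp _).symm

/-! ## Raw terms -/

/-- Raw terms with `n` free variables (de Bruijn indices). The names of the states, events and
transitions of `𝒯` are constants. A term that is the argument of a binder has the number of bound
variables added to its index; the last bound variable has index `0`. -/
inductive Tm (𝒯 : TransitionSystem.{u}) : ℕ → Type u
  | var {n : ℕ} (i : Fin n) : Tm 𝒯 n
  /- universes and propositions -/
  | uc {n : ℕ} (i : ℕ) : Tm 𝒯 n
  | ty {n : ℕ} (i : ℕ) : Tm 𝒯 n
  | prop {n : ℕ} : Tm 𝒯 n
  /- dependent products -/
  | pi {n : ℕ} (A : Tm 𝒯 n) (B : Tm 𝒯 (n + 1)) : Tm 𝒯 n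
  | lam {n : ℕ} (A : Tm 𝒯 n) (t : Tm 𝒯 (n + 1)) : Tm 𝒯 n
  | app {n : ℕ} (f a : Tm 𝒯 n) : Tm 𝒯 n
  /- binary products -/
  | prod {n : ℕ} (A B : Tm 𝒯 n) : Tm 𝒯 n
  | pair {n : ℕ} (a b : Tm 𝒯 n) : Tm 𝒯 n
  | fst {n : ℕ} (t : Tm 𝒯 n) : Tm 𝒯 n
  | snd {n : ℕ} (t : Tm 𝒯 n) : Tm 𝒯 n
  /- natural numbers -/
  | nat {n : ℕ} : Tm 𝒯 n
  | zero {n : ℕ} : Tm 𝒯 n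
  | succ {n : ℕ} (t : Tm 𝒯 n) : Tm 𝒯 n
  | natElim {n : ℕ} (P : Tm 𝒯 (n + 1)) (z : Tm 𝒯 n) (s : Tm 𝒯 (n + 2)) (t : Tm 𝒯 n) : Tm 𝒯 n
  /- states, events and transitions -/
  | state {n : ℕ} : Tm 𝒯 n
  | event {n : ℕ} : Tm 𝒯 n
  | step {n : ℕ} (s e s' : Tm 𝒯 n) : Tm 𝒯 n
  | stateC {n : ℕ} (s : 𝒯.State) : Tm 𝒯 n
  | eventC {n : ℕ} (e : 𝒯.Event) : Tm 𝒯 n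
  | stepC {n : ℕ} (x : Transition 𝒯) : Tm 𝒯 n
  /- finite traces -/
  | finTrace {n : ℕ} (s s' : Tm 𝒯 n) : Tm 𝒯 n
  | tnil {n : ℕ} (s : Tm 𝒯 n) : Tm 𝒯 n
  | tstep {n : ℕ} (τ e π : Tm 𝒯 n) : Tm 𝒯 n
  | traceElim {n : ℕ} (P : Tm 𝒯 (n + 2)) (b : Tm 𝒯 n) (s : Tm 𝒯 (n + 6)) (τ : Tm 𝒯 n) : Tm 𝒯 n
  /- infinite traces -/
  | infTrace {n : ℕ} : Tm 𝒯 n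
  | head {n : ℕ} (t : Tm 𝒯 n) : Tm 𝒯 n
  | tail {n : ℕ} (t : Tm 𝒯 n) : Tm 𝒯 n
  | corec {n : ℕ} (h e x : Tm 𝒯 (n + 1)) (a : Tm 𝒯 n) : Tm 𝒯 n
  /- trace extensions and knowledge -/
  | ext {n : ℕ} (τ τ' : Tm 𝒯 n) : Tm 𝒯 n
  | extId {n : ℕ} (τ : Tm 𝒯 n) : Tm 𝒯 n
  | extComp {n : ℕ} (ε ε' : Tm 𝒯 n) : Tm 𝒯 n
  | extStep {n : ℕ} (τ e π : Tm 𝒯 n) : Tm 𝒯 n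
  | know {n : ℕ} (τ : Tm 𝒯 n) : Tm 𝒯 n
  | restrict {n : ℕ} (ε k : Tm 𝒯 n) : Tm 𝒯 n

namespace Tm

/-- Extending a renaming under a binder. -/
def up {m n : ℕ} (f : Fin m → Fin n) : Fin (m + 1) → Fin (n + 1) :=
  Fin.cons 0 fun i => (f i).succ

def rename {m n : ℕ} (f : Fin m → Fin n) : Tm 𝒯 m → Tm 𝒯 n
  | var i => var (f i)
  | uc i => uc i
  | ty i => ty i
  | prop => prop
  | pi A B => pi (A.rename f) (B.rename (up f))
  | lam A t => lam (A.rename f) (t.rename (up f))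
  | app t a => app (t.rename f) (a.rename f)
  | prod A B => prod (A.rename f) (B.rename f)
  | pair a b => pair (a.rename f) (b.rename f)
  | fst t => fst (t.rename f)
  | snd t => snd (t.rename f)
  | nat => nat
  | zero => zero
  | succ t => succ (t.rename f)
  | natElim P z s t =>
      natElim (P.rename (up f)) (z.rename f) (s.rename (up (up f))) (t.rename f)
  | state => state
  | event => event
  | step s e s' => step (s.rename f) (e.rename f) (s'.rename f)
  | stateC s => stateC s
  | eventC e => eventC e
  | stepC x => stepC x
  | finTrace s s' => finTrace (s.rename f) (s'.rename f)
  | tnil s => tnil (s.rename f)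
  | tstep τ e π => tstep (τ.rename f) (e.rename f) (π.rename f)
  | traceElim P b s τ =>
      traceElim (P.rename (up (up f))) (b.rename f)
        (s.rename (up (up (up (up (up (up f))))))) (τ.rename f)
  | infTrace => infTrace
  | head t => head (t.rename f)
  | tail t => tail (t.rename f)
  | corec h e x a =>
      corec (h.rename (up f)) (e.rename (up f)) (x.rename (up f)) (a.rename f)
  | ext τ τ' => ext (τ.rename f) (τ'.rename f)
  | extId τ => extId (τ.rename f)
  | extComp ε ε' => extComp (ε.rename f) (ε'.rename f)
  | extStep τ e π => extStep (τ.rename f) (e.rename f) (π.rename f)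
  | know τ => know (τ.rename f)
  | restrict ε k => restrict (ε.rename f) (k.rename f)

/-- Weakening by one variable. -/
def wk {n : ℕ} (t : Tm 𝒯 n) : Tm 𝒯 (n + 1) := t.rename Fin.succ

/-- Extending a simultaneous substitution under a binder. -/
def lift {m n : ℕ} (σ : Fin m → Tm 𝒯 n) : Fin (m + 1) → Tm 𝒯 (n + 1) :=
  Fin.cons (var 0) fun i => (σ i).wk

/-- Capture-avoiding simultaneous substitution. -/
def subst {m n : ℕ} (σ : Fin m → Tm 𝒯 n) : Tm 𝒯 m → Tm 𝒯 n
  | var i => σ i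
  | uc i => uc i
  | ty i => ty i
  | prop => prop
  | pi A B => pi (A.subst σ) (B.subst (lift σ))
  | lam A t => lam (A.subst σ) (t.subst (lift σ))
  | app t a => app (t.subst σ) (a.subst σ)
  | prod A B => prod (A.subst σ) (B.subst σ)
  | pair a b => pair (a.subst σ) (b.subst σ)
  | fst t => fst (t.subst σ)
  | snd t => snd (t.subst σ)
  | nat => nat
  | zero => zero
  | succ t => succ (t.subst σ)
  | natElim P z s t =>
      natElim (P.subst (lift σ)) (z.subst σ) (s.subst (lift (lift σ))) (t.subst σ)
  | state => state
  | event => event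
  | step s e s' => step (s.subst σ) (e.subst σ) (s'.subst σ)
  | stateC s => stateC s
  | eventC e => eventC e
  | stepC x => stepC x
  | finTrace s s' => finTrace (s.subst σ) (s'.subst σ)
  | tnil s => tnil (s.subst σ)
  | tstep τ e π => tstep (τ.subst σ) (e.subst σ) (π.subst σ)
  | traceElim P b s τ =>
      traceElim (P.subst (lift (lift σ))) (b.subst σ)
        (s.subst (lift (lift (lift (lift (lift (lift σ))))))) (τ.subst σ)
  | infTrace => infTrace
  | head t => head (t.subst σ)
  | tail t => tail (t.subst σ)
  | corec h e x a =>
      corec (h.subst (lift σ)) (e.subst (lift σ)) (x.subst (lift σ)) (a.subst σ)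
  | ext τ τ' => ext (τ.subst σ) (τ'.subst σ)
  | extId τ => extId (τ.subst σ)
  | extComp ε ε' => extComp (ε.subst σ) (ε'.subst σ)
  | extStep τ e π => extStep (τ.subst σ) (e.subst σ) (π.subst σ)
  | know τ => know (τ.subst σ)
  | restrict ε k => restrict (ε.subst σ) (k.subst σ)

/-- The substitution `[a/x]` for the last variable. -/
def inst {n : ℕ} (a : Tm 𝒯 n) : Fin (n + 1) → Tm 𝒯 n := Fin.cons a var

/-- The motive `P(x, t)`, with `x : State` and `t : FinTrace(σ₀, x)` bound in this order, at
an end state `s` and a trace `τ`, all in a context that extends that of `P` by `k` variables. -/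
def motiveAt {n : ℕ} (P : Tm 𝒯 (n + 2)) (k : ℕ) (s τ : Tm 𝒯 (n + k)) : Tm 𝒯 (n + k) :=
  P.subst (Fin.cons τ (Fin.cons s fun i => var (i.addNat k)))

end Tm

/-! ## Contexts and derivable judgments -/

/-- Raw contexts of length `n`. -/
inductive Cxt (𝒯 : TransitionSystem.{u}) : ℕ → Type u
  | nil : Cxt 𝒯 0
  | cons {n : ℕ} (Γ : Cxt 𝒯 n) (A : Tm 𝒯 n) : Cxt 𝒯 (n + 1)

/-- The type of a variable, weakened to the whole context. -/
def Cxt.lookup : {n : ℕ} → Cxt 𝒯 n → Fin n → Tm 𝒯 n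
  | _, .nil => fun i => i.elim0
  | _, .cons Γ A => Fin.cons A.wk fun i => (Γ.lookup i).wk

/-- The universes of the computational and of the knowledge layer. -/
inductive Univ
  | uc (i : ℕ)
  | ty (i : ℕ)

def Univ.tm {n : ℕ} : Univ → Tm 𝒯 n
  | .uc i => .uc i
  | .ty i => .ty i

def Univ.level : Univ → ℕ
  | .uc i => i
  | .ty i => i

/-- The judgment forms `⊢ Γ ctx`, `Γ ⊢ t : A` and `Γ ⊢ t ≡ u : A`. -/
inductive Judgment (𝒯 : TransitionSystem.{u})
  | ctx {n : ℕ} (Γ : Cxt 𝒯 n)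
  | typ {n : ℕ} (Γ : Cxt 𝒯 n) (t A : Tm 𝒯 n)
  | eq {n : ℕ} (Γ : Cxt 𝒯 n) (t u A : Tm 𝒯 n)

open Tm Judgment in
/-- Derivability in DEKL over the transition system `𝒯`, with universe levels up to `N` (all
levels if `N = ⊤`) and with the knowledge family `K` in `Type_ℓ`. -/
inductive Derivable (𝒯 : TransitionSystem.{u}) (N : ℕ∞) (ℓ : ℕ) : Judgment 𝒯 → Prop
  /- contexts, variables, conversion -/
  | ctxEmpty : Derivable 𝒯 N ℓ (ctx .nil)
  | ctxExt {n : ℕ} {Γ : Cxt 𝒯 n} {A : Tm 𝒯 n} {U : Univ} :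
      Derivable 𝒯 N ℓ (ctx Γ) → Derivable 𝒯 N ℓ (typ Γ A U.tm) →
      Derivable 𝒯 N ℓ (ctx (Γ.cons A))
  | var {n : ℕ} {Γ : Cxt 𝒯 n} (i : Fin n) :
      Derivable 𝒯 N ℓ (ctx Γ) → Derivable 𝒯 N ℓ (typ Γ (var i) (Γ.lookup i))
  | conv {n : ℕ} {Γ : Cxt 𝒯 n} {t A B : Tm 𝒯 n} {U : Univ} :
      Derivable 𝒯 N ℓ (typ Γ t A) → Derivable 𝒯 N ℓ (eq Γ A B U.tm) →
      Derivable 𝒯 N ℓ (typ Γ t B)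
  | eqRefl {n : ℕ} {Γ : Cxt 𝒯 n} {t A : Tm 𝒯 n} :
      Derivable 𝒯 N ℓ (typ Γ t A) → Derivable 𝒯 N ℓ (eq Γ t t A)
  | eqSymm {n : ℕ} {Γ : Cxt 𝒯 n} {t u A : Tm 𝒯 n} :
      Derivable 𝒯 N ℓ (eq Γ t u A) → Derivable 𝒯 N ℓ (eq Γ u t A)
  | eqTrans {n : ℕ} {Γ : Cxt 𝒯 n} {t u v A : Tm 𝒯 n} :
      Derivable 𝒯 N ℓ (eq Γ t u A) → Derivable 𝒯 N ℓ (eq Γ u v A) →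
      Derivable 𝒯 N ℓ (eq Γ t v A)
  | eqConv {n : ℕ} {Γ : Cxt 𝒯 n} {t u A B : Tm 𝒯 n} {U : Univ} :
      Derivable 𝒯 N ℓ (eq Γ t u A) → Derivable 𝒯 N ℓ (eq Γ A B U.tm) →
      Derivable 𝒯 N ℓ (eq Γ t u B)
  /- universes -/
  | ucForm {n : ℕ} {Γ : Cxt 𝒯 n} (i : ℕ) (hi : ((i + 1 : ℕ) : ℕ∞) ≤ N) :
      Derivable 𝒯 N ℓ (ctx Γ) → Derivable 𝒯 N ℓ (typ Γ (uc i) (uc (i + 1)))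
  | tyForm {n : ℕ} {Γ : Cxt 𝒯 n} (i : ℕ) (hi : ((i + 1 : ℕ) : ℕ∞) ≤ N) :
      Derivable 𝒯 N ℓ (ctx Γ) → Derivable 𝒯 N ℓ (typ Γ (ty i) (ty (i + 1)))
  | propForm {n : ℕ} {Γ : Cxt 𝒯 n} :
      Derivable 𝒯 N ℓ (ctx Γ) → Derivable 𝒯 N ℓ (typ Γ prop (ty 0))
  /- dependent products -/
  | piForm {n : ℕ} {Γ : Cxt 𝒯 n} {A : Tm 𝒯 n} {B : Tm 𝒯 (n + 1)} {U : Univ}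
      (hU : (U.level : ℕ∞) ≤ N) :
      Derivable 𝒯 N ℓ (typ Γ A U.tm) → Derivable 𝒯 N ℓ (typ (Γ.cons A) B U.tm) →
      Derivable 𝒯 N ℓ (typ Γ (pi A B) U.tm)
  | piIntro {n : ℕ} {Γ : Cxt 𝒯 n} {A : Tm 𝒯 n} {t B : Tm 𝒯 (n + 1)} :
      Derivable 𝒯 N ℓ (typ (Γ.cons A) t B) →
      Derivable 𝒯 N ℓ (typ Γ (lam A t) (pi A B))
  | piElim {n : ℕ} {Γ : Cxt 𝒯 n} {f a A : Tm 𝒯 n} {B : Tm 𝒯 (n + 1)} :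
      Derivable 𝒯 N ℓ (typ Γ f (pi A B)) → Derivable 𝒯 N ℓ (typ Γ a A) →
      Derivable 𝒯 N ℓ (typ Γ (app f a) (B.subst (inst a)))
  | piBeta {n : ℕ} {Γ : Cxt 𝒯 n} {a A : Tm 𝒯 n} {b B : Tm 𝒯 (n + 1)} :
      Derivable 𝒯 N ℓ (typ Γ a A) → Derivable 𝒯 N ℓ (typ (Γ.cons A) b B) →
      Derivable 𝒯 N ℓ (eq Γ (app (lam A b) a) (b.subst (inst a)) (B.subst (inst a)))
  | piCong {n : ℕ} {Γ : Cxt 𝒯 n} {A A' : Tm 𝒯 n} {B B' : Tm 𝒯 (n + 1)} {U : Univ}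
      (hU : (U.level : ℕ∞) ≤ N) :
      Derivable 𝒯 N ℓ (eq Γ A A' U.tm) → Derivable 𝒯 N ℓ (eq (Γ.cons A) B B' U.tm) →
      Derivable 𝒯 N ℓ (eq Γ (pi A B) (pi A' B') U.tm)
  | lamCong {n : ℕ} {Γ : Cxt 𝒯 n} {A A' : Tm 𝒯 n} {t t' B : Tm 𝒯 (n + 1)} {U : Univ} :
      Derivable 𝒯 N ℓ (eq Γ A A' U.tm) → Derivable 𝒯 N ℓ (eq (Γ.cons A) t t' B) →
      Derivable 𝒯 N ℓ (eq Γ (lam A t) (lam A' t') (pi A B))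
  | appCong {n : ℕ} {Γ : Cxt 𝒯 n} {f f' a a' A : Tm 𝒯 n} {B : Tm 𝒯 (n + 1)} :
      Derivable 𝒯 N ℓ (eq Γ f f' (pi A B)) → Derivable 𝒯 N ℓ (eq Γ a a' A) →
      Derivable 𝒯 N ℓ (eq Γ (app f a) (app f' a') (B.subst (inst a)))
  /- binary products -/
  | prodForm {n : ℕ} {Γ : Cxt 𝒯 n} {A B : Tm 𝒯 n} {U : Univ} (hU : (U.level : ℕ∞) ≤ N) :
      Derivable 𝒯 N ℓ (typ Γ A U.tm) → Derivable 𝒯 N ℓ (typ Γ B U.tm) →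
      Derivable 𝒯 N ℓ (typ Γ (prod A B) U.tm)
  | prodIntro {n : ℕ} {Γ : Cxt 𝒯 n} {a b A B : Tm 𝒯 n} :
      Derivable 𝒯 N ℓ (typ Γ a A) → Derivable 𝒯 N ℓ (typ Γ b B) →
      Derivable 𝒯 N ℓ (typ Γ (pair a b) (prod A B))
  | prodFst {n : ℕ} {Γ : Cxt 𝒯 n} {t A B : Tm 𝒯 n} :
      Derivable 𝒯 N ℓ (typ Γ t (prod A B)) → Derivable 𝒯 N ℓ (typ Γ (fst t) A)
  | prodSnd {n : ℕ} {Γ : Cxt 𝒯 n} {t A B : Tm 𝒯 n} :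
      Derivable 𝒯 N ℓ (typ Γ t (prod A B)) → Derivable 𝒯 N ℓ (typ Γ (snd t) B)
  | fstBeta {n : ℕ} {Γ : Cxt 𝒯 n} {a b A B : Tm 𝒯 n} :
      Derivable 𝒯 N ℓ (typ Γ a A) → Derivable 𝒯 N ℓ (typ Γ b B) →
      Derivable 𝒯 N ℓ (eq Γ (fst (pair a b)) a A)
  | sndBeta {n : ℕ} {Γ : Cxt 𝒯 n} {a b A B : Tm 𝒯 n} :
      Derivable 𝒯 N ℓ (typ Γ a A) → Derivable 𝒯 N ℓ (typ Γ b B) →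
      Derivable 𝒯 N ℓ (eq Γ (snd (pair a b)) b B)
  | prodCong {n : ℕ} {Γ : Cxt 𝒯 n} {A A' B B' : Tm 𝒯 n} {U : Univ}
      (hU : (U.level : ℕ∞) ≤ N) :
      Derivable 𝒯 N ℓ (eq Γ A A' U.tm) → Derivable 𝒯 N ℓ (eq Γ B B' U.tm) →
      Derivable 𝒯 N ℓ (eq Γ (prod A B) (prod A' B') U.tm)
  | pairCong {n : ℕ} {Γ : Cxt 𝒯 n} {a a' b b' A B : Tm 𝒯 n} :
      Derivable 𝒯 N ℓ (eq Γ a a' A) → Derivable 𝒯 N ℓ (eq Γ b b' B) →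
      Derivable 𝒯 N ℓ (eq Γ (pair a b) (pair a' b') (prod A B))
  | fstCong {n : ℕ} {Γ : Cxt 𝒯 n} {t t' A B : Tm 𝒯 n} :
      Derivable 𝒯 N ℓ (eq Γ t t' (prod A B)) → Derivable 𝒯 N ℓ (eq Γ (fst t) (fst t') A)
  | sndCong {n : ℕ} {Γ : Cxt 𝒯 n} {t t' A B : Tm 𝒯 n} :
      Derivable 𝒯 N ℓ (eq Γ t t' (prod A B)) → Derivable 𝒯 N ℓ (eq Γ (snd t) (snd t') B)
  /- natural numbers -/
  | natForm {n : ℕ} {Γ : Cxt 𝒯 n} :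
      Derivable 𝒯 N ℓ (ctx Γ) → Derivable 𝒯 N ℓ (typ Γ nat (uc 0))
  | natZero {n : ℕ} {Γ : Cxt 𝒯 n} :
      Derivable 𝒯 N ℓ (ctx Γ) → Derivable 𝒯 N ℓ (typ Γ zero nat)
  | natSucc {n : ℕ} {Γ : Cxt 𝒯 n} {t : Tm 𝒯 n} :
      Derivable 𝒯 N ℓ (typ Γ t nat) → Derivable 𝒯 N ℓ (typ Γ (succ t) nat)
  | natElim {n : ℕ} {Γ : Cxt 𝒯 n} {P : Tm 𝒯 (n + 1)} {z : Tm 𝒯 n} {s : Tm 𝒯 (n + 2)}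
      {t : Tm 𝒯 n} {U : Univ} :
      Derivable 𝒯 N ℓ (typ (Γ.cons nat) P U.tm) →
      Derivable 𝒯 N ℓ (typ Γ z (P.subst (inst zero))) →
      Derivable 𝒯 N ℓ (typ ((Γ.cons nat).cons P) s
        (P.subst (Fin.cons (succ (.var 1)) fun i => .var (i.addNat 2)))) →
      Derivable 𝒯 N ℓ (typ Γ t nat) →
      Derivable 𝒯 N ℓ (typ Γ (natElim P z s t) (P.subst (inst t)))
  | natElimZero {n : ℕ} {Γ : Cxt 𝒯 n} {P : Tm 𝒯 (n + 1)} {z : Tm 𝒯 n} {s : Tm 𝒯 (n + 2)}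
      {U : Univ} :
      Derivable 𝒯 N ℓ (typ (Γ.cons nat) P U.tm) →
      Derivable 𝒯 N ℓ (typ Γ z (P.subst (inst zero))) →
      Derivable 𝒯 N ℓ (typ ((Γ.cons nat).cons P) s
        (P.subst (Fin.cons (succ (.var 1)) fun i => .var (i.addNat 2)))) →
      Derivable 𝒯 N ℓ (eq Γ (natElim P z s zero) z (P.subst (inst zero)))
  | natElimSucc {n : ℕ} {Γ : Cxt 𝒯 n} {P : Tm 𝒯 (n + 1)} {z : Tm 𝒯 n} {s : Tm 𝒯 (n + 2)}
      {t : Tm 𝒯 n} {U : Univ} :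
      Derivable 𝒯 N ℓ (typ (Γ.cons nat) P U.tm) →
      Derivable 𝒯 N ℓ (typ Γ z (P.subst (inst zero))) →
      Derivable 𝒯 N ℓ (typ ((Γ.cons nat).cons P) s
        (P.subst (Fin.cons (succ (.var 1)) fun i => .var (i.addNat 2)))) →
      Derivable 𝒯 N ℓ (typ Γ t nat) →
      Derivable 𝒯 N ℓ (eq Γ (natElim P z s (succ t))
        (s.subst (Fin.cons (natElim P z s t) (inst t))) (P.subst (inst (succ t))))
  | succCong {n : ℕ} {Γ : Cxt 𝒯 n} {t t' : Tm 𝒯 n} :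
      Derivable 𝒯 N ℓ (eq Γ t t' nat) → Derivable 𝒯 N ℓ (eq Γ (succ t) (succ t') nat)
  | natElimCong {n : ℕ} {Γ : Cxt 𝒯 n} {P P' : Tm 𝒯 (n + 1)} {z z' : Tm 𝒯 n}
      {s s' : Tm 𝒯 (n + 2)} {t t' : Tm 𝒯 n} {U : Univ} :
      Derivable 𝒯 N ℓ (eq (Γ.cons nat) P P' U.tm) →
      Derivable 𝒯 N ℓ (eq Γ z z' (P.subst (inst zero))) →
      Derivable 𝒯 N ℓ (eq ((Γ.cons nat).cons P) s s'
        (P.subst (Fin.cons (succ (.var 1)) fun i => .var (i.addNat 2)))) →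
      Derivable 𝒯 N ℓ (eq Γ t t' nat) →
      Derivable 𝒯 N ℓ (eq Γ (natElim P z s t) (natElim P' z' s' t') (P.subst (inst t)))
  /- states, events and transitions -/
  | stateForm {n : ℕ} {Γ : Cxt 𝒯 n} :
      Derivable 𝒯 N ℓ (ctx Γ) → Derivable 𝒯 N ℓ (typ Γ state (uc 0))
  | eventForm {n : ℕ} {Γ : Cxt 𝒯 n} :
      Derivable 𝒯 N ℓ (ctx Γ) → Derivable 𝒯 N ℓ (typ Γ event (uc 0))
  | stepForm {n : ℕ} {Γ : Cxt 𝒯 n} {s e s' : Tm 𝒯 n} :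
      Derivable 𝒯 N ℓ (typ Γ s state) → Derivable 𝒯 N ℓ (typ Γ e event) →
      Derivable 𝒯 N ℓ (typ Γ s' state) → Derivable 𝒯 N ℓ (typ Γ (step s e s') (uc 0))
  | stateConst {n : ℕ} {Γ : Cxt 𝒯 n} (s : 𝒯.State) :
      Derivable 𝒯 N ℓ (ctx Γ) → Derivable 𝒯 N ℓ (typ Γ (stateC s) state)
  | eventConst {n : ℕ} {Γ : Cxt 𝒯 n} (e : 𝒯.Event) :
      Derivable 𝒯 N ℓ (ctx Γ) → Derivable 𝒯 N ℓ (typ Γ (eventC e) event)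
  | stepConst {n : ℕ} {Γ : Cxt 𝒯 n} (x : Transition 𝒯) :
      Derivable 𝒯 N ℓ (ctx Γ) →
      Derivable 𝒯 N ℓ (typ Γ (stepC x) (step (stateC x.src) (eventC x.ev) (stateC x.tgt)))
  | stepCong {n : ℕ} {Γ : Cxt 𝒯 n} {s₁ s₂ e e' s₁' s₂' : Tm 𝒯 n} :
      Derivable 𝒯 N ℓ (eq Γ s₁ s₁' state) → Derivable 𝒯 N ℓ (eq Γ e e' event) →
      Derivable 𝒯 N ℓ (eq Γ s₂ s₂' state) →
      Derivable 𝒯 N ℓ (eq Γ (step s₁ e s₂) (step s₁' e' s₂') (uc 0))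
  /- finite traces: formation, constructors, eliminator, computation -/
  | finTraceForm {n : ℕ} {Γ : Cxt 𝒯 n} {s s' : Tm 𝒯 n} :
      Derivable 𝒯 N ℓ (typ Γ s state) → Derivable 𝒯 N ℓ (typ Γ s' state) →
      Derivable 𝒯 N ℓ (typ Γ (finTrace s s') (uc 0))
  | traceNil {n : ℕ} {Γ : Cxt 𝒯 n} {s : Tm 𝒯 n} :
      Derivable 𝒯 N ℓ (typ Γ s state) → Derivable 𝒯 N ℓ (typ Γ (tnil s) (finTrace s s))
  | traceStep {n : ℕ} {Γ : Cxt 𝒯 n} {s₀ s₁ s₂ τ e π : Tm 𝒯 n} :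
      Derivable 𝒯 N ℓ (typ Γ τ (finTrace s₀ s₁)) → Derivable 𝒯 N ℓ (typ Γ e event) →
      Derivable 𝒯 N ℓ (typ Γ π (step s₁ e s₂)) →
      Derivable 𝒯 N ℓ (typ Γ (tstep τ e π) (finTrace s₀ s₂))
  /- The motive `P` lives over `x : State, t : FinTrace(σ₀, x)`; the step case lives over
     `x : State, t : FinTrace(σ₀, x), e : Event, y : State, π : Step(x, e, y), h : P(x, t)`. -/
  | traceElim {n : ℕ} {Γ : Cxt 𝒯 n} {P : Tm 𝒯 (n + 2)} {b : Tm 𝒯 n} {s : Tm 𝒯 (n + 6)}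
      {s₀ s₁ τ : Tm 𝒯 n} {U : Univ} :
      Derivable 𝒯 N ℓ (typ Γ s₀ state) →
      Derivable 𝒯 N ℓ (typ ((Γ.cons state).cons (finTrace s₀.wk (.var 0))) P U.tm) →
      Derivable 𝒯 N ℓ (typ Γ b (motiveAt P 0 s₀ (tnil s₀))) →
      Derivable 𝒯 N ℓ (typ ((((((Γ.cons state).cons (finTrace s₀.wk (.var 0))).cons event).cons
          state).cons (step (.var 3) (.var 1) (.var 0))).cons (motiveAt P 5 (.var 4) (.var 3))) s
        (motiveAt P 6 (.var 2) (tstep (.var 4) (.var 3) (.var 1)))) →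
      Derivable 𝒯 N ℓ (typ Γ τ (finTrace s₀ s₁)) →
      Derivable 𝒯 N ℓ (typ Γ (traceElim P b s τ) (motiveAt P 0 s₁ τ))
  | traceElimNil {n : ℕ} {Γ : Cxt 𝒯 n} {P : Tm 𝒯 (n + 2)} {b : Tm 𝒯 n} {s : Tm 𝒯 (n + 6)}
      {s₀ : Tm 𝒯 n} {U : Univ} :
      Derivable 𝒯 N ℓ (typ Γ s₀ state) →
      Derivable 𝒯 N ℓ (typ ((Γ.cons state).cons (finTrace s₀.wk (.var 0))) P U.tm) →
      Derivable 𝒯 N ℓ (typ Γ b (motiveAt P 0 s₀ (tnil s₀))) →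
      Derivable 𝒯 N ℓ (typ ((((((Γ.cons state).cons (finTrace s₀.wk (.var 0))).cons event).cons
          state).cons (step (.var 3) (.var 1) (.var 0))).cons (motiveAt P 5 (.var 4) (.var 3))) s
        (motiveAt P 6 (.var 2) (tstep (.var 4) (.var 3) (.var 1)))) →
      Derivable 𝒯 N ℓ (eq Γ (traceElim P b s (tnil s₀)) b (motiveAt P 0 s₀ (tnil s₀)))
  | traceElimStep {n : ℕ} {Γ : Cxt 𝒯 n} {P : Tm 𝒯 (n + 2)} {b : Tm 𝒯 n} {s : Tm 𝒯 (n + 6)}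
      {s₀ s₁ s₂ τ e π : Tm 𝒯 n} {U : Univ} :
      Derivable 𝒯 N ℓ (typ Γ s₀ state) →
      Derivable 𝒯 N ℓ (typ ((Γ.cons state).cons (finTrace s₀.wk (.var 0))) P U.tm) →
      Derivable 𝒯 N ℓ (typ Γ b (motiveAt P 0 s₀ (tnil s₀))) →
      Derivable 𝒯 N ℓ (typ ((((((Γ.cons state).cons (finTrace s₀.wk (.var 0))).cons event).cons
          state).cons (step (.var 3) (.var 1) (.var 0))).cons (motiveAt P 5 (.var 4) (.var 3))) s
        (motiveAt P 6 (.var 2) (tstep (.var 4) (.var 3) (.var 1)))) →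
      Derivable 𝒯 N ℓ (typ Γ τ (finTrace s₀ s₁)) → Derivable 𝒯 N ℓ (typ Γ e event) →
      Derivable 𝒯 N ℓ (typ Γ π (step s₁ e s₂)) →
      Derivable 𝒯 N ℓ (eq Γ (traceElim P b s (tstep τ e π))
        (s.subst (Fin.cons (traceElim P b s τ) (Fin.cons π (Fin.cons s₂ (Fin.cons e
          (Fin.cons τ (inst s₁)))))))
        (motiveAt P 0 s₂ (tstep τ e π)))
  | finTraceCong {n : ℕ} {Γ : Cxt 𝒯 n} {s₁ s₂ s₁' s₂' : Tm 𝒯 n} :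
      Derivable 𝒯 N ℓ (eq Γ s₁ s₁' state) → Derivable 𝒯 N ℓ (eq Γ s₂ s₂' state) →
      Derivable 𝒯 N ℓ (eq Γ (finTrace s₁ s₂) (finTrace s₁' s₂') (uc 0))
  | tnilCong {n : ℕ} {Γ : Cxt 𝒯 n} {s s' : Tm 𝒯 n} :
      Derivable 𝒯 N ℓ (eq Γ s s' state) →
      Derivable 𝒯 N ℓ (eq Γ (tnil s) (tnil s') (finTrace s s))
  | tstepCong {n : ℕ} {Γ : Cxt 𝒯 n} {s₀ s₁ s₂ τ τ' e e' π π' : Tm 𝒯 n} :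
      Derivable 𝒯 N ℓ (eq Γ τ τ' (finTrace s₀ s₁)) → Derivable 𝒯 N ℓ (eq Γ e e' event) →
      Derivable 𝒯 N ℓ (eq Γ π π' (step s₁ e s₂)) →
      Derivable 𝒯 N ℓ (eq Γ (tstep τ e π) (tstep τ' e' π') (finTrace s₀ s₂))
  | traceElimCong {n : ℕ} {Γ : Cxt 𝒯 n} {P P' : Tm 𝒯 (n + 2)} {b b' : Tm 𝒯 n}
      {s s' : Tm 𝒯 (n + 6)} {s₀ s₁ τ τ' : Tm 𝒯 n} {U : Univ} :
      Derivable 𝒯 N ℓ (typ Γ s₀ state) →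
      Derivable 𝒯 N ℓ (eq ((Γ.cons state).cons (finTrace s₀.wk (.var 0))) P P' U.tm) →
      Derivable 𝒯 N ℓ (eq Γ b b' (motiveAt P 0 s₀ (tnil s₀))) →
      Derivable 𝒯 N ℓ (eq ((((((Γ.cons state).cons (finTrace s₀.wk (.var 0))).cons event).cons
          state).cons (step (.var 3) (.var 1) (.var 0))).cons (motiveAt P 5 (.var 4) (.var 3)))
        s s' (motiveAt P 6 (.var 2) (tstep (.var 4) (.var 3) (.var 1)))) →
      Derivable 𝒯 N ℓ (eq Γ τ τ' (finTrace s₀ s₁)) →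
      Derivable 𝒯 N ℓ (eq Γ (traceElim P b s τ) (traceElim P' b' s' τ') (motiveAt P 0 s₁ τ))
  /- infinite traces: destructors and corecursion -/
  | infTraceForm {n : ℕ} {Γ : Cxt 𝒯 n} :
      Derivable 𝒯 N ℓ (ctx Γ) → Derivable 𝒯 N ℓ (typ Γ infTrace (uc 0))
  | infHead {n : ℕ} {Γ : Cxt 𝒯 n} {t : Tm 𝒯 n} :
      Derivable 𝒯 N ℓ (typ Γ t infTrace) → Derivable 𝒯 N ℓ (typ Γ (head t) state)
  | infTail {n : ℕ} {Γ : Cxt 𝒯 n} {t : Tm 𝒯 n} :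
      Derivable 𝒯 N ℓ (typ Γ t infTrace) →
      Derivable 𝒯 N ℓ (typ Γ (tail t) (prod event infTrace))
  | infCorec {n : ℕ} {Γ : Cxt 𝒯 n} {X a : Tm 𝒯 n} {h e x : Tm 𝒯 (n + 1)} {U : Univ} :
      Derivable 𝒯 N ℓ (typ Γ X U.tm) → Derivable 𝒯 N ℓ (typ (Γ.cons X) h state) →
      Derivable 𝒯 N ℓ (typ (Γ.cons X) e event) → Derivable 𝒯 N ℓ (typ (Γ.cons X) x X.wk) →
      Derivable 𝒯 N ℓ (typ Γ a X) → Derivable 𝒯 N ℓ (typ Γ (corec h e x a) infTrace)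
  | headCorec {n : ℕ} {Γ : Cxt 𝒯 n} {X a : Tm 𝒯 n} {h e x : Tm 𝒯 (n + 1)} {U : Univ} :
      Derivable 𝒯 N ℓ (typ Γ X U.tm) → Derivable 𝒯 N ℓ (typ (Γ.cons X) h state) →
      Derivable 𝒯 N ℓ (typ (Γ.cons X) e event) → Derivable 𝒯 N ℓ (typ (Γ.cons X) x X.wk) →
      Derivable 𝒯 N ℓ (typ Γ a X) →
      Derivable 𝒯 N ℓ (eq Γ (head (corec h e x a)) (h.subst (inst a)) state)
  | tailCorec {n : ℕ} {Γ : Cxt 𝒯 n} {X a : Tm 𝒯 n} {h e x : Tm 𝒯 (n + 1)} {U : Univ} :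
      Derivable 𝒯 N ℓ (typ Γ X U.tm) → Derivable 𝒯 N ℓ (typ (Γ.cons X) h state) →
      Derivable 𝒯 N ℓ (typ (Γ.cons X) e event) → Derivable 𝒯 N ℓ (typ (Γ.cons X) x X.wk) →
      Derivable 𝒯 N ℓ (typ Γ a X) →
      Derivable 𝒯 N ℓ (eq Γ (tail (corec h e x a))
        (pair (e.subst (inst a)) (corec h e x (x.subst (inst a)))) (prod event infTrace))
  | headCong {n : ℕ} {Γ : Cxt 𝒯 n} {t t' : Tm 𝒯 n} :
      Derivable 𝒯 N ℓ (eq Γ t t' infTrace) → Derivable 𝒯 N ℓ (eq Γ (head t) (head t') state)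
  | tailCong {n : ℕ} {Γ : Cxt 𝒯 n} {t t' : Tm 𝒯 n} :
      Derivable 𝒯 N ℓ (eq Γ t t' infTrace) →
      Derivable 𝒯 N ℓ (eq Γ (tail t) (tail t') (prod event infTrace))
  | corecCong {n : ℕ} {Γ : Cxt 𝒯 n} {X a a' : Tm 𝒯 n} {h h' e e' x x' : Tm 𝒯 (n + 1)}
      {U : Univ} :
      Derivable 𝒯 N ℓ (typ Γ X U.tm) → Derivable 𝒯 N ℓ (eq (Γ.cons X) h h' state) →
      Derivable 𝒯 N ℓ (eq (Γ.cons X) e e' event) →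
      Derivable 𝒯 N ℓ (eq (Γ.cons X) x x' X.wk) → Derivable 𝒯 N ℓ (eq Γ a a' X) →
      Derivable 𝒯 N ℓ (eq Γ (corec h e x a) (corec h' e' x' a') infTrace)
  /- trace extensions -/
  | extForm {n : ℕ} {Γ : Cxt 𝒯 n} {s₀ s₁ s₂ τ τ' : Tm 𝒯 n} :
      Derivable 𝒯 N ℓ (typ Γ τ (finTrace s₀ s₁)) → Derivable 𝒯 N ℓ (typ Γ τ' (finTrace s₀ s₂)) →
      Derivable 𝒯 N ℓ (typ Γ (ext τ τ') (uc 0))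
  | extId {n : ℕ} {Γ : Cxt 𝒯 n} {s₀ s₁ τ : Tm 𝒯 n} :
      Derivable 𝒯 N ℓ (typ Γ τ (finTrace s₀ s₁)) → Derivable 𝒯 N ℓ (typ Γ (extId τ) (ext τ τ))
  | extComp {n : ℕ} {Γ : Cxt 𝒯 n} {τ τ' τ'' ε ε' : Tm 𝒯 n} :
      Derivable 𝒯 N ℓ (typ Γ ε (ext τ τ')) → Derivable 𝒯 N ℓ (typ Γ ε' (ext τ' τ'')) →
      Derivable 𝒯 N ℓ (typ Γ (extComp ε ε') (ext τ τ''))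
  | extStep {n : ℕ} {Γ : Cxt 𝒯 n} {s₀ s₁ s₂ τ e π : Tm 𝒯 n} :
      Derivable 𝒯 N ℓ (typ Γ τ (finTrace s₀ s₁)) → Derivable 𝒯 N ℓ (typ Γ e event) →
      Derivable 𝒯 N ℓ (typ Γ π (step s₁ e s₂)) →
      Derivable 𝒯 N ℓ (typ Γ (extStep τ e π) (ext τ (tstep τ e π)))
  | extCong {n : ℕ} {Γ : Cxt 𝒯 n} {s₀ s₁ s₂ τ₁ τ₂ τ₁' τ₂' : Tm 𝒯 n} :
      Derivable 𝒯 N ℓ (eq Γ τ₁ τ₁' (finTrace s₀ s₁)) →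
      Derivable 𝒯 N ℓ (eq Γ τ₂ τ₂' (finTrace s₀ s₂)) →
      Derivable 𝒯 N ℓ (eq Γ (ext τ₁ τ₂) (ext τ₁' τ₂') (uc 0))
  | extIdCong {n : ℕ} {Γ : Cxt 𝒯 n} {s₀ s₁ τ τ' : Tm 𝒯 n} :
      Derivable 𝒯 N ℓ (eq Γ τ τ' (finTrace s₀ s₁)) →
      Derivable 𝒯 N ℓ (eq Γ (extId τ) (extId τ') (ext τ τ))
  | extCompCong {n : ℕ} {Γ : Cxt 𝒯 n} {τ τ' τ'' ε₁ ε₁' ε₂ ε₂' : Tm 𝒯 n} :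
      Derivable 𝒯 N ℓ (eq Γ ε₁ ε₁' (ext τ τ')) → Derivable 𝒯 N ℓ (eq Γ ε₂ ε₂' (ext τ' τ'')) →
      Derivable 𝒯 N ℓ (eq Γ (extComp ε₁ ε₂) (extComp ε₁' ε₂') (ext τ τ''))
  | extStepCong {n : ℕ} {Γ : Cxt 𝒯 n} {s₀ s₁ s₂ τ τ' e e' π π' : Tm 𝒯 n} :
      Derivable 𝒯 N ℓ (eq Γ τ τ' (finTrace s₀ s₁)) → Derivable 𝒯 N ℓ (eq Γ e e' event) →
      Derivable 𝒯 N ℓ (eq Γ π π' (step s₁ e s₂)) →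
      Derivable 𝒯 N ℓ (eq Γ (extStep τ e π) (extStep τ' e' π') (ext τ (tstep τ e π)))
  /- trace-indexed knowledge and its restriction along extensions -/
  | knowForm {n : ℕ} {Γ : Cxt 𝒯 n} {s₀ s₁ τ : Tm 𝒯 n} :
      Derivable 𝒯 N ℓ (typ Γ τ (finTrace s₀ s₁)) → Derivable 𝒯 N ℓ (typ Γ (know τ) (ty ℓ))
  | restrict {n : ℕ} {Γ : Cxt 𝒯 n} {τ τ' ε k : Tm 𝒯 n} :
      Derivable 𝒯 N ℓ (typ Γ ε (ext τ τ')) → Derivable 𝒯 N ℓ (typ Γ k (know τ')) →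
      Derivable 𝒯 N ℓ (typ Γ (restrict ε k) (know τ))
  | restrictId {n : ℕ} {Γ : Cxt 𝒯 n} {s₀ s₁ τ k : Tm 𝒯 n} :
      Derivable 𝒯 N ℓ (typ Γ τ (finTrace s₀ s₁)) → Derivable 𝒯 N ℓ (typ Γ k (know τ)) →
      Derivable 𝒯 N ℓ (eq Γ (restrict (extId τ) k) k (know τ))
  | restrictComp {n : ℕ} {Γ : Cxt 𝒯 n} {τ τ' τ'' ε ε' k : Tm 𝒯 n} :
      Derivable 𝒯 N ℓ (typ Γ ε (ext τ τ')) → Derivable 𝒯 N ℓ (typ Γ ε' (ext τ' τ'')) →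
      Derivable 𝒯 N ℓ (typ Γ k (know τ'')) →
      Derivable 𝒯 N ℓ (eq Γ (restrict (extComp ε ε') k) (restrict ε (restrict ε' k)) (know τ))
  | knowCong {n : ℕ} {Γ : Cxt 𝒯 n} {s₀ s₁ τ τ' : Tm 𝒯 n} :
      Derivable 𝒯 N ℓ (eq Γ τ τ' (finTrace s₀ s₁)) →
      Derivable 𝒯 N ℓ (eq Γ (know τ) (know τ') (ty ℓ))
  | restrictCong {n : ℕ} {Γ : Cxt 𝒯 n} {τ τ' ε ε' k k' : Tm 𝒯 n} :
      Derivable 𝒯 N ℓ (eq Γ ε ε' (ext τ τ')) → Derivable 𝒯 N ℓ (eq Γ k k' (know τ')) →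
      Derivable 𝒯 N ℓ (eq Γ (restrict ε k) (restrict ε' k') (know τ))

/-- `Δ ⊢ σ : Γ`: a simultaneous substitution of terms over `Δ` for the variables of `Γ`. -/
def SubstDerivable (𝒯 : TransitionSystem.{u}) (N : ℕ∞) (ℓ : ℕ) {m n : ℕ}
    (Δ : Cxt 𝒯 m) (σ : Fin n → Tm 𝒯 m) (Γ : Cxt 𝒯 n) : Prop :=
  Derivable 𝒯 N ℓ (.ctx Δ) ∧
    ∀ i : Fin n, Derivable 𝒯 N ℓ (.typ Δ (σ i) ((Γ.lookup i).subst σ))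

/-! ## Set-theoretic operations -/

noncomputable section

/-- A fixed injection of a small type into the universe of sets (through a well-ordering of the
type), by which elements of the mathematical structures below are regarded as sets. -/
def code {α : Type u} (a : α) : ZFSet.{u} :=
  (Ordinal.typein (WellOrderingRel (α := α)) a).toZFSet

theorem code_injective {α : Type u} : Function.Injective (code : α → ZFSet.{u}) := fun _ _ h =>
  Ordinal.typein_injective WellOrderingRel (Ordinal.toZFSet_injective h)

/-- The set of the (codes of) elements of `α` that satisfy `P`. -/
def codeSet {α : Type u} (P : α → Prop) : ZFSet.{u} :=
  ZFSet.range fun a : {a : α // P a} => code a.1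

open Classical in
/-- `f a` if `z` is the code of `a`, and `∅` if `z` is not the code of an element of `α`. -/
def decode {α : Type u} (z : ZFSet.{u}) (f : α → ZFSet.{u}) : ZFSet.{u} :=
  if h : ∃ a : α, code a = z then f h.choose else ∅

/-- The graph of the function `f` on the set `A`. -/
def lamSet (A : ZFSet.{u}) (f : ZFSet.{u} → ZFSet.{u}) : ZFSet.{u} :=
  ZFSet.range fun x : {x : ZFSet.{u} // x ∈ A} => ZFSet.pair x.1 (f x.1)

/-- The dependent product of a family of sets: the set of graphs of its sections. -/
def piSet (A : ZFSet.{u}) (B : ZFSet.{u} → ZFSet.{u}) : ZFSet.{u} :=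
  ZFSet.range fun g : (∀ x : {x : ZFSet.{u} // x ∈ A}, {y : ZFSet.{u} // y ∈ B x.1}) =>
    ZFSet.range fun x : {x : ZFSet.{u} // x ∈ A} => ZFSet.pair x.1 (g x).1

open Classical in
/-- The value at `a` of the function with graph `f`. -/
def appSet (f a : ZFSet.{u}) : ZFSet.{u} :=
  if h : ∃ y, ZFSet.pair a y ∈ f then h.choose else ∅

open Classical in
def fstSet (z : ZFSet.{u}) : ZFSet.{u} :=
  if h : ∃ x y, z = ZFSet.pair x y then h.choose else ∅

open Classical in
def sndSet (z : ZFSet.{u}) : ZFSet.{u} :=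
  if h : ∃ y x, z = ZFSet.pair x y then h.choose else ∅

/-- Recursion along a trace starting in `s₀`: `b` at the empty trace, and `c` at a trace followed
by one more transition, applied to the shorter trace, the transition and the recursive value. -/
def traceRec {s₀ : 𝒯.State} (b : ZFSet.{u})
    (c : Trace 𝒯 → Transition 𝒯 → ZFSet.{u} → ZFSet.{u}) :
    {s : 𝒯.State} → Quiver.Path s₀ s → ZFSet.{u}
  | _, .nil => b
  | _, .cons (b := s') (c := s'') p x =>
      c ⟨s₀, s', p⟩ ⟨s', x.1, s'', x.2⟩ (traceRec b c p)

/-! ## The model -/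

/-- Infinite traces as elements of the final coalgebra of `X ↦ State × (Event × X)`. -/
abbrev InfTrace (𝒯 : TransitionSystem.{u}) : Type u := ℕ → 𝒯.State × 𝒯.Event

open Classical in
/-- The infinite trace unfolded from the seed `a`: its `k`-th state and event are the values of
`h` and `e` at the `k`-th iterate of `x` on `a`. -/
def corecSet (h e x : ZFSet.{u} → ZFSet.{u}) (a : ZFSet.{u}) : ZFSet.{u} :=
  if H : ∃ w : InfTrace 𝒯, ∀ k : ℕ,
      code (w k).1 = h (x^[k] a) ∧ code (w k).2 = e (x^[k] a)
  then code H.choose else ∅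

/-- The data of the model: the cardinals of the Grothendieck universes of the two hierarchies, and
the knowledge presheaf on the category of finite traces. -/
structure Model (𝒯 : TransitionSystem.{u}) where
  ucCard : ℕ → Cardinal.{u}
  tyCard : ℕ → Cardinal.{u}
  K : (Trace 𝒯)ᵒᵖ ⥤ Type u

/-- `κ₀ < κ₁ < ⋯` (up to index `N`) are inaccessible cardinals, and `𝒯` is `κ₀`-small. -/
structure IsHierarchy (𝒯 : TransitionSystem.{u}) (N : ℕ∞) (κ : ℕ → Cardinal.{u}) : Prop where
  inaccessible : ∀ i : ℕ, (i : ℕ∞) ≤ N → (κ i).IsInaccessible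
  lt_succ : ∀ i : ℕ, ((i + 1 : ℕ) : ℕ∞) ≤ N → κ i < κ (i + 1)
  state_lt : #𝒯.State < κ 0
  event_lt : #𝒯.Event < κ 0
  step_lt : ∀ s e s', #(𝒯.Step s e s') < κ 0

/-- Both universe hierarchies consist of Grothendieck universes, and the knowledge presheaf takes
values in the sets of level `ℓ`. -/
structure Model.IsAdmissible (M : Model 𝒯) (N : ℕ∞) (ℓ : ℕ) : Prop where
  uc : IsHierarchy 𝒯 N M.ucCard
  ty : IsHierarchy 𝒯 N M.tyCard
  K_lt : ∀ τ : Trace 𝒯, #(M.K.obj (op τ)) < M.tyCard ℓ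

namespace Model

variable (M : Model 𝒯)

/-- The subobjects of the terminal presheaf on the category of finite traces. -/
abbrev Truth (𝒯 : TransitionSystem.{u}) : Type u :=
  Subfunctor ((Functor.const (Trace 𝒯)ᵒᵖ).obj PUnit.{u + 1})

open Classical in
/-- The set denoted by a term under an assignment of sets to its variables. -/
def eval : {n : ℕ} → Tm 𝒯 n → (Fin n → ZFSet.{u}) → ZFSet.{u}
  | _, .var i, ρ => ρ i
  | _, .uc i, _ => ZFSet.vonNeumann (M.ucCard i).ord
  | _, .ty i, _ => ZFSet.vonNeumann (M.tyCard i).ord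
  | _, .prop, _ => codeSet fun _ : Truth 𝒯 => True
  | _, .pi A B, ρ => piSet (eval A ρ) fun x => eval B (Fin.cons x ρ)
  | _, .lam A t, ρ => lamSet (eval A ρ) fun x => eval t (Fin.cons x ρ)
  | _, .app f a, ρ => appSet (eval f ρ) (eval a ρ)
  | _, .prod A B, ρ => (eval A ρ).prod (eval B ρ)
  | _, .pair a b, ρ => ZFSet.pair (eval a ρ) (eval b ρ)
  | _, .fst t, ρ => fstSet (eval t ρ)
  | _, .snd t, ρ => sndSet (eval t ρ)
  | _, .nat, _ => codeSet fun _ : ULift.{u} ℕ => True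
  | _, .zero, _ => code (ULift.up.{u} (0 : ℕ))
  | _, .succ t, ρ => decode (eval t ρ) fun k : ULift.{u} ℕ => code (ULift.up.{u} (k.down + 1))
  | _, .natElim _ z s t, ρ => decode (eval t ρ) fun k : ULift.{u} ℕ =>
      Nat.rec (eval z ρ)
        (fun j r => eval s (Fin.cons r (Fin.cons (code (ULift.up.{u} j)) ρ))) k.down
  | _, .state, _ => codeSet fun _ : 𝒯.State => True
  | _, .event, _ => codeSet fun _ : 𝒯.Event => True
  | _, .step s e s', ρ => codeSet fun x : Transition 𝒯 =>
      code x.src = eval s ρ ∧ code x.ev = eval e ρ ∧ code x.tgt = eval s' ρ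
  | _, .stateC s, _ => code s
  | _, .eventC e, _ => code e
  | _, .stepC x, _ => code x
  | _, .finTrace s s', ρ => codeSet fun τ : Trace 𝒯 =>
      code τ.src = eval s ρ ∧ code τ.tgt = eval s' ρ
  | _, .tnil s, ρ => decode (eval s ρ) fun a : 𝒯.State => code (Trace.empty a)
  | _, .tstep τ _ π, ρ => decode (eval τ ρ) fun τ : Trace 𝒯 =>
      decode (eval π ρ) fun x : Transition 𝒯 =>
        if h : τ.tgt = x.src then code (τ.snoc x h) else ∅
  | _, .traceElim _ b s τ, ρ => decode (eval τ ρ) fun τ : Trace 𝒯 =>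
      traceRec (𝒯 := 𝒯) (s₀ := τ.src) (eval b ρ)
        (fun t x r => eval s (Fin.cons r (Fin.cons (code x) (Fin.cons (code x.tgt)
          (Fin.cons (code x.ev) (Fin.cons (code t) (Fin.cons (code x.src) ρ)))))))
        (s := τ.tgt) τ.hom
  | _, .infTrace, _ => codeSet fun _ : InfTrace 𝒯 => True
  | _, .head t, ρ => decode (eval t ρ) fun w : InfTrace 𝒯 => code (w 0).1
  | _, .tail t, ρ => decode (eval t ρ) fun w : InfTrace 𝒯 =>
      ZFSet.pair (code (w 0).2) (code fun k => w (k + 1))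
  | _, .corec h e x a, ρ =>
      corecSet (𝒯 := 𝒯) (fun y => eval h (Fin.cons y ρ)) (fun y => eval e (Fin.cons y ρ))
        (fun y => eval x (Fin.cons y ρ)) (eval a ρ)
  | _, .ext τ τ', ρ => codeSet fun f : Arrow (Trace 𝒯) =>
      code f.left = eval τ ρ ∧ code f.right = eval τ' ρ
  | _, .extId τ, ρ => decode (eval τ ρ) fun τ : Trace 𝒯 => code (Arrow.mk (𝟙 τ))
  | _, .extComp ε ε', ρ => decode (eval ε ρ) fun f : Arrow (Trace 𝒯) =>
      decode (eval ε' ρ) fun g : Arrow (Trace 𝒯) =>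
        if h : f.right = g.left then code (Arrow.mk (f.hom ≫ eqToHom h ≫ g.hom)) else ∅
  | _, .extStep τ _ π, ρ => decode (eval τ ρ) fun τ : Trace 𝒯 =>
      decode (eval π ρ) fun x : Transition 𝒯 =>
        if h : τ.tgt = x.src then code (Arrow.mk (τ.snocExt x h)) else ∅
  | _, .know τ, ρ => codeSet fun k : M.K.Elements => code k.1.unop = eval τ ρ
  | _, .restrict ε k, ρ => decode (eval ε ρ) fun f : Arrow (Trace 𝒯) =>
      decode (eval k ρ) fun k : M.K.Elements =>
        if h : k.1 = op f.right then
          code (M.K.elementsMk (op f.left) (M.K.map (eqToHom h ≫ f.hom.op) k.2))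
        else ∅

/-- The interpretation of a raw context, built by iterated comprehension in the set-theoretic
category with families, together with the assignment given by each of its points. -/
def ctxEnv : {n : ℕ} → Cxt 𝒯 n → Σ X : setCwF.{u}.Ctx, (X → Fin n → ZFSet.{u})
  | _, .nil => ⟨setCwF.empty, fun _ => Fin.elim0⟩
  | _, .cons Γ A => ⟨setCwF.ext (ctxEnv Γ).1 (fun γ => M.eval A ((ctxEnv Γ).2 γ)),
      fun x => Fin.cons x.2.1 ((ctxEnv Γ).2 x.1)⟩

/-- `⟦Γ⟧`. -/
def ctx {n : ℕ} (Γ : Cxt 𝒯 n) : setCwF.{u}.Ctx := (M.ctxEnv Γ).1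

/-- The assignment of sets to variables given by a point of `⟦Γ⟧`. -/
def env {n : ℕ} (Γ : Cxt 𝒯 n) : M.ctx Γ → Fin n → ZFSet.{u} := (M.ctxEnv Γ).2

/-- `⟦A⟧`, as a type over `⟦Γ⟧`. -/
def type {n : ℕ} (Γ : Cxt 𝒯 n) (A : Tm 𝒯 n) : setCwF.{u}.Ty (M.ctx Γ) :=
  fun γ => M.eval A (M.env Γ γ)

/-- `a` is the interpretation `⟦t⟧` of `t` as a term of type `⟦A⟧` over `⟦Γ⟧`. -/
def Interprets {n : ℕ} (Γ : Cxt 𝒯 n) (t A : Tm 𝒯 n)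
    (a : setCwF.{u}.Tm (M.ctx Γ) (M.type Γ A)) : Prop :=
  ∀ γ : M.ctx Γ, (a γ).1 = M.eval t (M.env Γ γ)

/-- `f` is the interpretation `⟦σ⟧ : ⟦Δ⟧ ⟶ ⟦Γ⟧` of a simultaneous substitution. -/
def InterpretsSubst {m n : ℕ} (Δ : Cxt 𝒯 m) (σ : Fin n → Tm 𝒯 m) (Γ : Cxt 𝒯 n)
    (f : M.ctx Δ ⟶ M.ctx Γ) : Prop :=
  ∀ (δ : M.ctx Δ) (i : Fin n), M.env Γ (setFun f δ) i = M.eval (σ i) (M.env Δ δ)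

end Model

end

end DEKL

open DEKL CategoryTheory Opposite

open Cardinal

namespace DEKL

/-! ## Sets below an inaccessible cardinal -/

section VonNeumann

open ZFSet

variable {c : Cardinal.{u}} {x y : ZFSet.{u}}

/-! The interpretation `Model.eval` is total on raw terms: its partial operations return the empty
set outside their intended domain. Hence the value of a term does not depend on a derivation. No
coherence question arises, uniqueness is immediate, and the substitution lemma `Model.eval_subst` is
a structural induction on raw terms that makes no reference to typing. Derivability only serves to
show that the values are the intended ones.

This is done by a single induction on derivations, `Model.valid_of_derivable`. A typing judgment is
valid if, at every point of the context, the value of the term lies in the value of the type. An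
equation is valid if the two values agree and, in addition, lie in the type. The second half is
indispensable: most premises of the congruence rules are equations, and bodies of abstractions, step
cases and corecursors are known to agree only on the sets they are meant to be applied to.

Three facts feed the induction. First, a stage `V_κ` with `κ` inaccessible is closed under products
and dependent products, and a structure with fewer than `κ` elements is coded by ordinals below `κ`;
cardinal estimates for traces, extensions, infinite traces and truth values then place every base
type in its universe. Second, traces and extensions are coded together with their end points and
codes are injective, so membership in a type recovers composable data, and the computation rules
become the equations of recursion on paths and of iteration. Third, the equations for restriction
are functoriality of the presheaf.

For substitutions, the points of a context correspond bijectively to the assignments that satisfy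
its types (`Model.env_mem`, `Model.env_injective`, `Model.exists_env_eq`). A derivable substitution
therefore induces exactly one map of contexts, and its compatibility with types and terms is
`Model.eval_subst` read pointwise. -/

theorem powerset_mem_vonNeumann (hc : c.IsInaccessible) (hx : x ∈ V_ c.ord) :
    x.powerset ∈ V_ c.ord := by
  rw [mem_vonNeumann] at *
  rw [rank_powerset]
  exact (isSuccLimit_ord hc.1.le).succ_lt hx

theorem union_mem_vonNeumann (hx : x ∈ V_ c.ord) (hy : y ∈ V_ c.ord) : x ∪ y ∈ V_ c.ord := by
  rw [mem_vonNeumann] at *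
  rw [rank_union]
  exact max_lt hx hy

/-- A set is contained in the stage of its own rank, whose size is a value of `preBeth`; an
inaccessible cardinal is a fixed point of this strictly increasing function. -/
theorem card_lt_of_mem_vonNeumann (hc : c.IsInaccessible) (hx : x ∈ V_ c.ord) : x.card < c := by
  rw [mem_vonNeumann] at hx
  calc x.card ≤ (V_ x.rank).card := card_mono (subset_vonNeumann_self x)
    _ = preBeth x.rank := card_vonNeumann _
    _ < preBeth c.ord := preBeth_strictMono hx
    _ = c := hc.preBeth_ord

/-- Replacement inside `V_ c.ord`: by regularity, fewer than `c` ranks below `c.ord` are bounded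
below `c.ord`. The index type may live in a higher universe, as the type of elements of a `ZFSet`
does, and is shrunk first. -/
theorem range_mem_vonNeumann {α : Type v} [Small.{u} α] (hc : c.IsInaccessible)
    {f : α → ZFSet.{u}} (hα : #(Shrink.{u} α) < c) (hf : ∀ a, f a ∈ V_ c.ord) :
    range f ∈ V_ c.ord := by
  have h : range f = range (f ∘ (equivShrink α).symm) := by
    ext z
    simp only [mem_range, Function.comp_apply]
    exact (equivShrink α).symm.surjective.exists
  rw [h]
  rw [mem_vonNeumann, rank_range]
  refine Ordinal.iSup_lt_of_lt_cof (by rwa [hc.isRegular.cof_ord]) fun a => ?_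
  exact (isSuccLimit_ord hc.1.le).succ_lt (mem_vonNeumann.1 (hf _))

theorem sUnion_mem_vonNeumann (hx : x ∈ V_ c.ord) : ⋃₀ x ∈ V_ c.ord := by
  rw [mem_vonNeumann] at *
  exact (rank_sUnion_le x).trans_lt hx

/-- Kuratowski pairs of elements of `x` and `y` are sets of subsets of `x ∪ y`, so two power sets
suffice. -/
theorem prod_mem_vonNeumann (hc : c.IsInaccessible) (hx : x ∈ V_ c.ord) (hy : y ∈ V_ c.ord) :
    x.prod y ∈ V_ c.ord := by
  refine mem_vonNeumann_of_subset ?_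
    (powerset_mem_vonNeumann hc (powerset_mem_vonNeumann hc (union_mem_vonNeumann hx hy)))
  intro p hp
  obtain ⟨a, ha, b, hb, rfl⟩ := mem_prod.1 hp
  simp only [pair, mem_powerset]
  intro z hz
  rw [mem_powerset]
  intro w hw
  rw [mem_union]
  rcases mem_pair.1 hz with rfl | rfl
  · rw [mem_singleton.1 hw]
    exact .inl ha
  · rcases mem_pair.1 hw with rfl | rfl
    · exact .inl ha
    · exact .inr hb

/-- A section is a subset of the product of `x` with the union of all fibres. That union stays in
the stage by replacement, which applies because `x` has fewer than `c` elements. -/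
theorem piSet_mem_vonNeumann (hc : c.IsInaccessible) {B : ZFSet.{u} → ZFSet.{u}}
    (hx : x ∈ V_ c.ord) (hB : ∀ a ∈ x, B a ∈ V_ c.ord) : piSet x B ∈ V_ c.ord := by
  have hcard : #(Shrink.{u} {a : ZFSet.{u} // a ∈ x}) < c := by
    exact card_lt_of_mem_vonNeumann hc hx
  have hS : (⋃₀ range fun a : {a : ZFSet.{u} // a ∈ x} => B a.1) ∈ V_ c.ord :=
    sUnion_mem_vonNeumann (range_mem_vonNeumann hc hcard fun a => hB a.1 a.2)
  refine mem_vonNeumann_of_subset ?_ (powerset_mem_vonNeumann hc (prod_mem_vonNeumann hc hx hS))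
  intro f hf
  obtain ⟨g, rfl⟩ := mem_range.1 hf
  rw [mem_powerset]
  intro p hp
  obtain ⟨a, rfl⟩ := mem_range.1 hp
  rw [pair_mem_prod]
  exact ⟨a.2, mem_sUnion.2 ⟨_, mem_range_self a, (g a).2⟩⟩

/-- The code of `a` is an ordinal, hence its own rank, and its cardinality is the number of
predecessors of `a`, at most `#α`. -/
theorem code_mem_vonNeumann {α : Type u} (hα : #α < c) (a : α) : code a ∈ V_ c.ord := by
  rw [mem_vonNeumann, code, Ordinal.rank_toZFSet, lt_ord]
  refine lt_of_le_of_lt ?_ hα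
  rw [Ordinal.card_typein]
  exact mk_subtype_le _

theorem codeSet_mem_vonNeumann (hc : c.IsInaccessible) {α : Type u} (hα : #α < c) (P : α → Prop) :
    codeSet P ∈ V_ c.ord := by
  refine range_mem_vonNeumann hc ?_ fun a => code_mem_vonNeumann hα a.1
  rw [← mk_congr (equivShrink.{u} {a : α // P a})]
  exact (mk_subtype_le _).trans_lt hα

end VonNeumann

/-! ## Set-theoretic operations -/

theorem mem_codeSet {α : Type u} {P : α → Prop} {z : ZFSet.{u}} :
    z ∈ codeSet P ↔ ∃ a, P a ∧ code a = z := by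
  simp [codeSet]

@[simp]
theorem decode_code {α : Type u} (a : α) (f : α → ZFSet.{u}) : decode (code a) f = f a := by
  have h : ∃ b : α, code b = code a := ⟨a, rfl⟩
  rw [decode, dif_pos h, code_injective h.choose_spec]

@[simp]
theorem fstSet_pair (x y : ZFSet.{u}) : fstSet (ZFSet.pair x y) = x := by
  have h : ∃ x' y', ZFSet.pair x y = ZFSet.pair x' y' := ⟨x, y, rfl⟩
  rw [fstSet, dif_pos h]
  exact (ZFSet.pair_injective h.choose_spec.choose_spec).1.symm

@[simp]
theorem sndSet_pair (x y : ZFSet.{u}) : sndSet (ZFSet.pair x y) = y := by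
  have h : ∃ y' x', ZFSet.pair x y = ZFSet.pair x' y' := ⟨y, x, rfl⟩
  rw [sndSet, dif_pos h]
  exact (ZFSet.pair_injective h.choose_spec.choose_spec).2.symm

theorem appSet_lamSet {A a : ZFSet.{u}} (f : ZFSet.{u} → ZFSet.{u}) (ha : a ∈ A) :
    appSet (lamSet A f) a = f a := by
  have h : ∃ y, ZFSet.pair a y ∈ lamSet A f :=
    ⟨f a, ZFSet.mem_range.2 ⟨⟨a, ha⟩, rfl⟩⟩
  rw [appSet, dif_pos h]
  obtain ⟨x, hx⟩ := ZFSet.mem_range.1 h.choose_spec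
  obtain ⟨h₁, h₂⟩ := ZFSet.pair_injective hx
  rw [← h₂, h₁]

theorem lamSet_congr {A : ZFSet.{u}} {f g : ZFSet.{u} → ZFSet.{u}} (h : ∀ x ∈ A, f x = g x) :
    lamSet A f = lamSet A g := by
  unfold lamSet
  congr 1
  funext x
  rw [h x.1 x.2]

theorem piSet_congr {A : ZFSet.{u}} {B B' : ZFSet.{u} → ZFSet.{u}} (h : ∀ x ∈ A, B x = B' x) :
    piSet A B = piSet A B' := by
  ext z
  simp only [piSet, ZFSet.mem_range]
  constructor
  · rintro ⟨g, rfl⟩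
    exact ⟨fun x => ⟨(g x).1, h x.1 x.2 ▸ (g x).2⟩, rfl⟩
  · rintro ⟨g, rfl⟩
    exact ⟨fun x => ⟨(g x).1, (h x.1 x.2).symm ▸ (g x).2⟩, rfl⟩

theorem lamSet_mem_piSet {A : ZFSet.{u}} {B f : ZFSet.{u} → ZFSet.{u}}
    (h : ∀ x ∈ A, f x ∈ B x) : lamSet A f ∈ piSet A B :=
  ZFSet.mem_range.2 ⟨fun x => ⟨f x.1, h x.1 x.2⟩, rfl⟩

theorem appSet_mem {A a f : ZFSet.{u}} {B : ZFSet.{u} → ZFSet.{u}} (hf : f ∈ piSet A B)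
    (ha : a ∈ A) : appSet f a ∈ B a := by
  obtain ⟨g, rfl⟩ := ZFSet.mem_range.1 hf
  have h : ∃ y, ZFSet.pair a y ∈
      ZFSet.range fun x : {x : ZFSet.{u} // x ∈ A} => ZFSet.pair x.1 (g x).1 :=
    ⟨_, ZFSet.mem_range.2 ⟨⟨a, ha⟩, rfl⟩⟩
  rw [appSet, dif_pos h]
  obtain ⟨x, hx⟩ := ZFSet.mem_range.1 h.choose_spec
  obtain ⟨h₁, h₂⟩ := ZFSet.pair_injective hx
  rw [← h₂, ← h₁]
  exact (g x).2

/-- The unfolding equations prescribe the code of every state and event, so they have at most one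
solution and the choice in `corecSet` is forced. -/
theorem corecSet_eq {𝒯 : TransitionSystem.{u}} {h e x : ZFSet.{u} → ZFSet.{u}} {a : ZFSet.{u}}
    (w : InfTrace 𝒯) (hw : ∀ k : ℕ, code (w k).1 = h (x^[k] a) ∧ code (w k).2 = e (x^[k] a)) :
    corecSet (𝒯 := 𝒯) h e x a = code w := by
  have H : ∃ w : InfTrace 𝒯, ∀ k : ℕ,
    code (w k).1 = h (x^[k] a) ∧ code (w k).2 = e (x^[k] a) := ⟨w, hw⟩
  rw [corecSet, dif_pos H]
  congr 1
  funext k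
  obtain ⟨h₁, h₂⟩ := H.choose_spec k
  exact Prod.ext (code_injective (h₁.trans (hw k).1.symm))
    (code_injective (h₂.trans (hw k).2.symm))

theorem corecSet_congr {𝒯 : TransitionSystem.{u}} {h h' e e' x x' : ZFSet.{u} → ZFSet.{u}}
    {a a' : ZFSet.{u}}
    (H : ∀ k : ℕ, h (x^[k] a) = h' (x'^[k] a') ∧ e (x^[k] a) = e' (x'^[k] a')) :
    corecSet (𝒯 := 𝒯) h e x a = corecSet (𝒯 := 𝒯) h' e' x' a' := by
  by_cases hw : ∃ w : InfTrace 𝒯, ∀ k : ℕ,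
    code (w k).1 = h (x^[k] a) ∧ code (w k).2 = e (x^[k] a)
  · obtain ⟨w, hw⟩ := hw
    rw [corecSet_eq w hw, corecSet_eq w fun k => (H k).1 ▸ (H k).2 ▸ hw k]
  -- If one unfolding problem has no solution, neither has the other, and both sides take the
  -- default value.
  · have hw' := hw
    simp only [H] at hw'
    rw [corecSet, corecSet, dif_neg hw, dif_neg hw']

/-- All iterates of `x` on the seed remain in `X`, where `h` and `e` take codes of states and events
as values. -/
theorem exists_infTrace {𝒯 : TransitionSystem.{u}} {X : ZFSet.{u}} {h e x : ZFSet.{u} → ZFSet.{u}}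
    (hh : ∀ y ∈ X, ∃ s : 𝒯.State, code s = h y) (he : ∀ y ∈ X, ∃ s : 𝒯.Event, code s = e y)
    (hx : ∀ y ∈ X, x y ∈ X) {a : ZFSet.{u}} (ha : a ∈ X) :
    ∃ w : InfTrace 𝒯, ∀ k : ℕ, code (w k).1 = h (x^[k] a) ∧ code (w k).2 = e (x^[k] a) := by
  have hk : ∀ k : ℕ, x^[k] a ∈ X := by
    intro k
    induction k with
    | zero => exact ha
    | succ k ih => rw [Function.iterate_succ_apply']; exact hx _ ih
  choose f hf using fun k => hh _ (hk k)
  choose g hg using fun k => he _ (hk k)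
  exact ⟨fun k => (f k, g k), fun k => ⟨hf k, hg k⟩⟩

theorem iterate_eq_of_eqOn {X : ZFSet.{u}} {x x' : ZFSet.{u} → ZFSet.{u}}
    (hx : ∀ y ∈ X, x y ∈ X) (h : ∀ y ∈ X, x y = x' y) {a : ZFSet.{u}} (ha : a ∈ X) (k : ℕ) :
    x^[k] a ∈ X ∧ x^[k] a = x'^[k] a := by
  induction k with
  | zero => exact ⟨ha, rfl⟩
  | succ k ih =>
    rw [Function.iterate_succ_apply', Function.iterate_succ_apply', ← ih.2]
    exact ⟨hx _ ih.1, h _ ih.1⟩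

/-! ## Sizes of the mathematical structures -/

section Size

variable {𝒯 : TransitionSystem.{u}} {c : Cardinal.{u}}

theorem mk_sigma_lt (hc : c.IsInaccessible) {α : Type u} {β : α → Type u} (hα : #α < c)
    (hβ : ∀ a, #(β a) < c) : #(Σ a, β a) < c := by
  rw [mk_sigma]
  exact sum_lt_of_isRegular hc.isRegular hα hβ

/-- With `m` the maximum of `ℵ₀`, `a` and `b`, the power is at most `2 ^ (m * m) = 2 ^ m`, which is
below a strong limit. -/
theorem power_lt_of_isInaccessible (hc : c.IsInaccessible) {a b : Cardinal.{u}} (ha : a < c)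
    (hb : b < c) : a ^ b < c := by
  have hm : max ℵ₀ (max a b) < c := max_lt hc.1 (max_lt ha hb)
  calc a ^ b ≤ (max ℵ₀ (max a b)) ^ b := power_le_power_right (by simp)
    _ ≤ (2 ^ max ℵ₀ (max a b)) ^ b := power_le_power_right (cantor _).le
    _ = 2 ^ (max ℵ₀ (max a b) * b) := (power_mul ..).symm
    _ ≤ 2 ^ (max ℵ₀ (max a b) * max ℵ₀ (max a b)) :=
        power_le_power_left two_ne_zero (mul_le_mul_right (by simp) _)
    _ < c := by
      rw [mul_eq_self (le_max_left _ _)]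
      exact hc.isStrongPrelimit hm

/-- The list of the transitions of a path, the last one first. -/
def pathTransitions {s : 𝒯.State} : {s' : 𝒯.State} → Quiver.Path s s' →
    List (Transition 𝒯)
  | _, .nil => []
  | _, .cons p x => ⟨_, x.1, _, x.2⟩ :: pathTransitions p

/-- Each listed transition records its source, so the intermediate states of a path can be read off
from the list. This bounds the number of paths by the number of lists. -/
theorem pathTransitions_injective {s s' : 𝒯.State} (p q : Quiver.Path s s')
    (h : pathTransitions p = pathTransitions q) : p = q := by
  induction p with
  | nil =>
    cases q with
    | nil => rfl
    | cons q y => simp [pathTransitions] at h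
  | cons p x ih =>
    cases q with
    | nil => simp [pathTransitions] at h
    | cons q y =>
      obtain ⟨e, x⟩ := x
      obtain ⟨e', y⟩ := y
      simp only [pathTransitions, List.cons.injEq, Transition.mk.injEq] at h
      obtain ⟨⟨rfl, rfl, -, h⟩, h'⟩ := h
      cases h
      rw [ih _ h']

/-- The transition system is `c`-small. -/
structure SmallSystem (𝒯 : TransitionSystem.{u}) (c : Cardinal.{u}) : Prop where
  inaccessible : c.IsInaccessible
  state_lt : #𝒯.State < c
  event_lt : #𝒯.Event < c
  step_lt : ∀ s e s', #(𝒯.Step s e s') < c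

namespace SmallSystem

theorem transition_lt (h : SmallSystem 𝒯 c) : #(Transition 𝒯) < c := by
  refine lt_of_le_of_lt (mk_le_of_injective
    (f := fun x : Transition 𝒯 => (⟨x.src, x.ev, x.tgt, x.wit⟩ :
      Σ s : 𝒯.State, Σ e : 𝒯.Event, Σ s' : 𝒯.State, 𝒯.Step s e s')) ?_)
    (mk_sigma_lt h.inaccessible h.state_lt fun s => mk_sigma_lt h.inaccessible h.event_lt
      fun e => mk_sigma_lt h.inaccessible h.state_lt fun s' => h.step_lt s e s')
  rintro ⟨⟩ ⟨⟩ h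
  cases h
  rfl

theorem path_lt (h : SmallSystem 𝒯 c) (s s' : 𝒯.State) : #(Quiver.Path s s') < c := by
  refine lt_of_le_of_lt (mk_le_of_injective (f := pathTransitions)
    fun p q => pathTransitions_injective p q) ?_
  exact (mk_list_le_max _).trans_lt (max_lt h.inaccessible.1 h.transition_lt)

theorem trace_lt (h : SmallSystem 𝒯 c) : #(Trace 𝒯) < c := by
  refine lt_of_le_of_lt (mk_le_of_injective
    (f := fun x : Trace 𝒯 => (⟨x.src, x.tgt, x.hom⟩ :
      Σ s : 𝒯.State, Σ s' : 𝒯.State, Quiver.Path s s')) ?_)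
    (mk_sigma_lt h.inaccessible h.state_lt fun s => mk_sigma_lt h.inaccessible h.state_lt
      fun s' => h.path_lt s s')
  rintro ⟨⟩ ⟨⟩ h
  cases h
  rfl

theorem traceExt_lt (h : SmallSystem 𝒯 c) (t t' : Trace 𝒯) : #(t ⟶ t') < c :=
  lt_of_le_of_lt (mk_le_of_injective (f := fun f : t ⟶ t' => (TraceExt.tail f :
    Quiver.Path t.tgt t'.tgt)) fun _ _ h => TraceExt.ext h) (h.path_lt t.tgt t'.tgt)

theorem arrow_lt (h : SmallSystem 𝒯 c) : #(Arrow (Trace 𝒯)) < c := by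
  refine lt_of_le_of_lt (mk_le_of_surjective
    (f := fun f : Σ t : Trace 𝒯, Σ t' : Trace 𝒯, (t ⟶ t') => Arrow.mk f.2.2) ?_)
    (mk_sigma_lt h.inaccessible h.trace_lt fun t => mk_sigma_lt h.inaccessible h.trace_lt
      fun t' => h.traceExt_lt t t')
  exact fun f => ⟨⟨f.left, f.right, f.hom⟩, rfl⟩

theorem infTrace_lt (h : SmallSystem 𝒯 c) : #(InfTrace 𝒯) < c := by
  have h₁ : #(InfTrace 𝒯) = (#𝒯.State * #𝒯.Event) ^ ℵ₀ := by simp [InfTrace]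
  rw [h₁]
  exact power_lt_of_isInaccessible h.inaccessible
    (mul_lt_of_lt h.inaccessible.1.le h.state_lt h.event_lt) h.inaccessible.1

/-- A subobject of the terminal presheaf is determined by the set of traces at which it is
inhabited, so there are at most `2 ^ #(Trace 𝒯)` of them. -/
theorem truth_lt (h : SmallSystem 𝒯 c) : #(Model.Truth 𝒯) < c := by
  refine lt_of_le_of_lt (mk_le_of_injective
    (f := fun F : Model.Truth 𝒯 => {t : Trace 𝒯 | PUnit.unit ∈ F.obj (op t)}) ?_) ?_
  · intro F G hFG
    ext t ⟨⟩
    exact Set.ext_iff.1 hFG t.unop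
  · rw [mk_set]
    exact h.inaccessible.isStrongPrelimit h.trace_lt

theorem nat_lt (h : SmallSystem 𝒯 c) : #(ULift.{u} ℕ) < c := by
  simpa using h.inaccessible.1

end SmallSystem

end Size

variable {𝒯 : TransitionSystem.{u}} {N : ℕ∞} {ℓ : ℕ}

/-! ## Renaming and substitution in the model -/

namespace Model

variable (M : Model 𝒯)

theorem cons_comp_up {m n : ℕ} (x : ZFSet.{u}) (ρ : Fin n → ZFSet.{u}) (f : Fin m → Fin n) :
    (fun i => (Fin.cons x ρ : Fin (n + 1) → ZFSet.{u}) (Tm.up f i)) =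
      Fin.cons x fun i => ρ (f i) := by
  funext i
  refine Fin.cases ?_ (fun i => ?_) i <;> simp [Tm.up]

theorem eval_rename {m n : ℕ} (t : Tm 𝒯 m) (f : Fin m → Fin n) (ρ : Fin n → ZFSet.{u}) :
    M.eval (t.rename f) ρ = M.eval t fun i => ρ (f i) := by
  induction t generalizing n <;> simp only [Tm.rename, eval, cons_comp_up, *]

@[simp]
theorem eval_wk {n : ℕ} (t : Tm 𝒯 n) (x : ZFSet.{u}) (ρ : Fin n → ZFSet.{u}) :
    M.eval t.wk (Fin.cons x ρ) = M.eval t ρ := by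
  rw [Tm.wk, eval_rename]
  rfl

theorem eval_lift {m n : ℕ} (x : ZFSet.{u}) (σ : Fin m → Tm 𝒯 n) (ρ : Fin n → ZFSet.{u}) :
    (fun i => M.eval (Tm.lift σ i) (Fin.cons x ρ)) = Fin.cons x fun i => M.eval (σ i) ρ := by
  funext i
  refine Fin.cases ?_ (fun i => ?_) i
  · rfl
  · simp [Tm.lift]

/-- The semantic substitution lemma. Every clause of `eval` is compositional; the only interaction
is at binders, where `eval_lift` identifies the lifted substitution with the extended assignment.
Lifting weakens the substituted terms, so renaming has to be treated first. -/
theorem eval_subst {m n : ℕ} (t : Tm 𝒯 m) (σ : Fin m → Tm 𝒯 n) (ρ : Fin n → ZFSet.{u}) :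
    M.eval (t.subst σ) ρ = M.eval t fun i => M.eval (σ i) ρ := by
  induction t generalizing n <;> simp only [Tm.subst, eval, eval_lift, *]

theorem eval_cons {m n : ℕ} (a : Tm 𝒯 n) (σ : Fin m → Tm 𝒯 n) (ρ : Fin n → ZFSet.{u}) :
    (fun i => M.eval ((Fin.cons a σ : Fin (m + 1) → Tm 𝒯 n) i) ρ) =
      Fin.cons (M.eval a ρ) fun i => M.eval (σ i) ρ := by
  funext i
  refine Fin.cases ?_ (fun i => ?_) i <;> rfl

theorem eval_inst {n : ℕ} (a : Tm 𝒯 n) (ρ : Fin n → ZFSet.{u}) :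
    (fun i => M.eval (Tm.inst a i) ρ) = Fin.cons (M.eval a ρ) ρ :=
  M.eval_cons a Tm.var ρ

theorem eval_subst_inst {n : ℕ} (t : Tm 𝒯 (n + 1)) (a : Tm 𝒯 n) (ρ : Fin n → ZFSet.{u}) :
    M.eval (t.subst (Tm.inst a)) ρ = M.eval t (Fin.cons (M.eval a ρ) ρ) := by
  rw [eval_subst, eval_inst]

theorem eval_motiveAt {n : ℕ} (P : Tm 𝒯 (n + 2)) (k : ℕ) (s τ : Tm 𝒯 (n + k))
    (ρ : Fin (n + k) → ZFSet.{u}) :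
    M.eval (Tm.motiveAt P k s τ) ρ =
      M.eval P (Fin.cons (M.eval τ ρ) (Fin.cons (M.eval s ρ) fun i => ρ (i.addNat k))) := by
  rw [Tm.motiveAt, eval_subst, eval_cons, eval_cons]
  rfl

/-! ## Points of contexts -/

/-- The property `Q` holds at all points of `⟦Γ⟧`. -/
def Forall {n : ℕ} (Γ : Cxt 𝒯 n) (Q : (Fin n → ZFSet.{u}) → Prop) : Prop :=
  ∀ γ : M.ctx Γ, Q (M.env Γ γ)

theorem forall_cons {n : ℕ} {Γ : Cxt 𝒯 n} {A : Tm 𝒯 n} {Q : (Fin (n + 1) → ZFSet.{u}) → Prop} :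
    M.Forall (Γ.cons A) Q ↔ M.Forall Γ fun ρ => ∀ x ∈ M.eval A ρ, Q (Fin.cons x ρ) :=
  ⟨fun h γ x hx => h ⟨γ, ⟨x, hx⟩⟩, fun h γ => h γ.1 γ.2.1 γ.2.2⟩

theorem env_mem {n : ℕ} (Γ : Cxt 𝒯 n) (γ : M.ctx Γ) (i : Fin n) :
    M.env Γ γ i ∈ M.eval (Γ.lookup i) (M.env Γ γ) := by
  induction Γ with
  | nil => exact i.elim0
  | cons Γ A ih =>
    -- Once the point is split into a shorter point and a last value, `eval_wk` strips the weakening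
    -- in `lookup`.
    refine (M.forall_cons (Q := fun ρ => ρ i ∈ M.eval ((Γ.cons A).lookup i) ρ)).2 ?_ γ
    intro γ x hx
    refine Fin.cases ?_ (fun i => ?_) i
    · simpa [Cxt.lookup] using hx
    · simpa [Cxt.lookup] using ih γ i

/-- A point of a context consists of the values of its variables and of proofs of membership. This
makes the interpretation of a substitution unique. -/
theorem env_injective {n : ℕ} (Γ : Cxt 𝒯 n) : Function.Injective (M.env Γ) := by
  induction Γ with
  | nil => exact fun _ _ _ => rfl
  | cons Γ A ih =>
    rintro ⟨γ, x, hx⟩ ⟨γ', x', hx'⟩ h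
    obtain ⟨h₁, h₂⟩ := (Fin.cons_inj (α := fun _ => ZFSet.{u}) (x₀ := x) (y₀ := x')
      (x := M.env Γ γ) (y := M.env Γ γ')).1 h
    have h₃ : γ = γ' := ih h₂
    subst h₃
    have h₄ : x = x' := h₁
    subst h₄
    rfl

/-- The converse of `env_mem`: each type sees only the earlier variables, so a well-typed assignment
is assembled into a point one variable at a time. It provides the map that interprets a
substitution. -/
theorem exists_env_eq {n : ℕ} (Γ : Cxt 𝒯 n) (ρ : Fin n → ZFSet.{u})
    (h : ∀ i, ρ i ∈ M.eval (Γ.lookup i) ρ) : ∃ γ : M.ctx Γ, M.env Γ γ = ρ := by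
  induction Γ with
  | nil => exact ⟨PUnit.unit, funext fun i => i.elim0⟩
  | cons Γ A ih =>
    obtain ⟨x, ρ, rfl⟩ : ∃ x ρ', ρ = Fin.cons x ρ' := ⟨_, _, (Fin.cons_self_tail ρ).symm⟩
    obtain ⟨γ, rfl⟩ := ih ρ fun i => by simpa [Cxt.lookup] using h i.succ
    have hx : x ∈ M.eval A (M.env Γ γ) := by simpa [Cxt.lookup] using h 0
    exact ⟨⟨γ, ⟨x, hx⟩⟩, rfl⟩

end Model

/-! ## Recursion along traces -/

/-- The motive `Q` may be indexed by bundled traces because a trace carries its end state; the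
dependence of the motive on that state is absorbed. -/
theorem traceRec_mem {s₀ : 𝒯.State} {b : ZFSet.{u}}
    {c : Trace 𝒯 → Transition 𝒯 → ZFSet.{u} → ZFSet.{u}} (Q : Trace 𝒯 → ZFSet.{u})
    (hb : b ∈ Q (Trace.empty s₀))
    (hc : ∀ (t : Trace 𝒯) (x : Transition 𝒯) (h : t.tgt = x.src), t.src = s₀ →
      ∀ r ∈ Q t, c t x r ∈ Q (t.snoc x h)) {s : 𝒯.State} (p : Quiver.Path s₀ s) :
    traceRec b c p ∈ Q ⟨s₀, s, p⟩ := by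
  induction p with
  | nil => exact hb
  | cons p x ih =>
    have h := hc ⟨s₀, _, p⟩ ⟨_, x.1, _, x.2⟩ rfl rfl _ ih
    -- When the end points match on the nose, the transport inside `snoc` is an identity, and
    -- composing with a generator is definitionally `Path.cons`.
    have h' : (Trace.mk s₀ _ p : Trace 𝒯).snoc ⟨_, x.1, _, x.2⟩ rfl = ⟨s₀, _, p.cons x⟩ := by
      simp only [Trace.snoc, eqToHom_refl, Category.id_comp]
      rfl
    rwa [h'] at h

/-- The step functions agree only on recursive values in the motive, so agreement is propagated
together with membership. -/
theorem traceRec_congr {s₀ : 𝒯.State} {b : ZFSet.{u}}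
    {c c' : Trace 𝒯 → Transition 𝒯 → ZFSet.{u} → ZFSet.{u}} (Q : Trace 𝒯 → ZFSet.{u})
    (hb : b ∈ Q (Trace.empty s₀))
    (hc : ∀ (t : Trace 𝒯) (x : Transition 𝒯) (h : t.tgt = x.src), t.src = s₀ →
      ∀ r ∈ Q t, c t x r = c' t x r ∧ c t x r ∈ Q (t.snoc x h)) {s : 𝒯.State}
    (p : Quiver.Path s₀ s) : traceRec b c p = traceRec b c' p := by
  induction p with
  | nil => rfl
  | cons p x ih =>
    have h := traceRec_mem Q hb (fun t x h ht r hr => (hc t x h ht r hr).2) p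
    simp only [traceRec, ← ih]
    exact (hc ⟨s₀, _, p⟩ ⟨_, x.1, _, x.2⟩ rfl rfl _ h).1

theorem traceRec_snoc {b : ZFSet.{u}} {c : Trace 𝒯 → Transition 𝒯 → ZFSet.{u} → ZFSet.{u}}
    (t : Trace 𝒯) (x : Transition 𝒯) (h : t.tgt = x.src) :
    traceRec b c (s₀ := (t.snoc x h).src) (s := (t.snoc x h).tgt) (t.snoc x h).hom =
      c t x (traceRec b c (s₀ := t.src) (s := t.tgt) t.hom) := by
  obtain ⟨s₀, s, p⟩ := t
  obtain ⟨s', e, s'', w⟩ := x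
  dsimp only at h
  subst h
  have h' : (Trace.mk s₀ s p : Trace 𝒯).snoc ⟨s, e, s'', w⟩ rfl =
      ⟨s₀, s'', Quiver.Path.cons p ⟨e, w⟩⟩ := by
    simp only [Trace.snoc, eqToHom_refl, Category.id_comp]
    rfl
  rw [h']
  rfl

namespace Model

variable (M : Model 𝒯) {n : ℕ} {ρ : Fin n → ZFSet.{u}}

/-! ## Elements of the interpretations of types -/

theorem mem_nat {z : ZFSet.{u}} :
    z ∈ M.eval .nat ρ ↔ ∃ k : ℕ, code (ULift.up.{u} k) = z := by
  simp only [eval, mem_codeSet, true_and]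
  exact ULift.up_surjective.exists

theorem mem_state {z : ZFSet.{u}} : z ∈ M.eval .state ρ ↔ ∃ s : 𝒯.State, code s = z := by
  simp only [eval, mem_codeSet, true_and]

theorem mem_event {z : ZFSet.{u}} : z ∈ M.eval .event ρ ↔ ∃ e : 𝒯.Event, code e = z := by
  simp only [eval, mem_codeSet, true_and]

theorem mem_infTrace {z : ZFSet.{u}} :
    z ∈ M.eval .infTrace ρ ↔ ∃ w : InfTrace 𝒯, code w = z := by
  simp only [eval, mem_codeSet, true_and]

theorem mem_step {s e s' : Tm 𝒯 n} {z : ZFSet.{u}} :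
    z ∈ M.eval (.step s e s') ρ ↔ ∃ x : Transition 𝒯,
      (code x.src = M.eval s ρ ∧ code x.ev = M.eval e ρ ∧ code x.tgt = M.eval s' ρ) ∧
        code x = z := by
  simp only [eval, mem_codeSet]

theorem mem_finTrace {s s' : Tm 𝒯 n} {z : ZFSet.{u}} :
    z ∈ M.eval (.finTrace s s') ρ ↔ ∃ t : Trace 𝒯,
      (code t.src = M.eval s ρ ∧ code t.tgt = M.eval s' ρ) ∧ code t = z := by
  simp only [eval, mem_codeSet]

theorem mem_ext {τ τ' : Tm 𝒯 n} {z : ZFSet.{u}} :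
    z ∈ M.eval (.ext τ τ') ρ ↔ ∃ f : Arrow (Trace 𝒯),
      (code f.left = M.eval τ ρ ∧ code f.right = M.eval τ' ρ) ∧ code f = z := by
  simp only [eval, mem_codeSet]

theorem mem_know {τ : Tm 𝒯 n} {z : ZFSet.{u}} :
    z ∈ M.eval (.know τ) ρ ↔ ∃ k : M.K.Elements, code k.1.unop = M.eval τ ρ ∧ code k = z := by
  simp only [eval, mem_codeSet]

/-! ## Values of the constructors and of restriction -/

theorem eval_succ {t : Tm 𝒯 n} {k : ℕ} (h : code (ULift.up.{u} k) = M.eval t ρ) :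
    M.eval (.succ t) ρ = code (ULift.up.{u} (k + 1)) := by
  simp only [eval, ← h, decode_code]

theorem eval_tnil {s : Tm 𝒯 n} {a : 𝒯.State} (h : code a = M.eval s ρ) :
    M.eval (.tnil s) ρ = code (Trace.empty a) := by
  simp only [eval, ← h, decode_code]

theorem eval_tstep {τ e π : Tm 𝒯 n} {t : Trace 𝒯} {x : Transition 𝒯} (ht : code t = M.eval τ ρ)
    (hx : code x = M.eval π ρ) (h : t.tgt = x.src) :
    M.eval (.tstep τ e π) ρ = code (t.snoc x h) := by
  simp only [eval, ← ht, ← hx, decode_code, dif_pos h]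

theorem eval_extId {τ : Tm 𝒯 n} {t : Trace 𝒯} (h : code t = M.eval τ ρ) :
    M.eval (.extId τ) ρ = code (Arrow.mk (𝟙 t)) := by
  simp only [eval, ← h, decode_code]

theorem eval_extComp {ε ε' : Tm 𝒯 n} {f g : Arrow (Trace 𝒯)} (hf : code f = M.eval ε ρ)
    (hg : code g = M.eval ε' ρ) (h : f.right = g.left) :
    M.eval (.extComp ε ε') ρ = code (Arrow.mk (f.hom ≫ eqToHom h ≫ g.hom)) := by
  simp only [eval, ← hf, ← hg, decode_code, dif_pos h]

theorem eval_extStep {τ e π : Tm 𝒯 n} {t : Trace 𝒯} {x : Transition 𝒯}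
    (ht : code t = M.eval τ ρ) (hx : code x = M.eval π ρ) (h : t.tgt = x.src) :
    M.eval (.extStep τ e π) ρ = code (Arrow.mk (t.snocExt x h)) := by
  simp only [eval, ← ht, ← hx, decode_code, dif_pos h]

theorem eval_restrict {ε k : Tm 𝒯 n} {f : Arrow (Trace 𝒯)} {y : M.K.Elements}
    (hf : code f = M.eval ε ρ) (hy : code y = M.eval k ρ) (h : y.1 = op f.right) :
    M.eval (.restrict ε k) ρ =
      code (M.K.elementsMk (op f.left) (M.K.map (eqToHom h ≫ f.hom.op) y.2)) := by
  simp only [eval, ← hf, ← hy, decode_code, dif_pos h]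

/-! ## Eliminators -/

theorem natElim_mem {P : Tm 𝒯 (n + 1)} {z t : Tm 𝒯 n} {s : Tm 𝒯 (n + 2)}
    (hz : M.eval z ρ ∈ M.eval P (Fin.cons (code (ULift.up.{u} 0)) ρ))
    (hs : ∀ k : ℕ, ∀ r ∈ M.eval P (Fin.cons (code (ULift.up.{u} k)) ρ),
      M.eval s (Fin.cons r (Fin.cons (code (ULift.up.{u} k)) ρ)) ∈
        M.eval P (Fin.cons (code (ULift.up.{u} (k + 1))) ρ))
    (ht : M.eval t ρ ∈ M.eval .nat ρ) :
    M.eval (.natElim P z s t) ρ ∈ M.eval P (Fin.cons (M.eval t ρ) ρ) := by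
  obtain ⟨k, hk⟩ := M.mem_nat.1 ht
  simp only [eval, ← hk, decode_code]
  clear hk
  induction k with
  | zero => exact hz
  | succ k ih => exact hs k _ ih

/-- The step terms are known to agree only at values in the motive, so membership of all recursive
values, `hmem`, is established before the two recursions are compared. -/
theorem natElim_congr {P P' : Tm 𝒯 (n + 1)} {z z' t t' : Tm 𝒯 n} {s s' : Tm 𝒯 (n + 2)}
    (hz : M.eval z ρ = M.eval z' ρ ∧ M.eval z ρ ∈ M.eval P (Fin.cons (code (ULift.up.{u} 0)) ρ))
    (hs : ∀ k : ℕ, ∀ r ∈ M.eval P (Fin.cons (code (ULift.up.{u} k)) ρ),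
      M.eval s (Fin.cons r (Fin.cons (code (ULift.up.{u} k)) ρ)) =
        M.eval s' (Fin.cons r (Fin.cons (code (ULift.up.{u} k)) ρ)) ∧
      M.eval s (Fin.cons r (Fin.cons (code (ULift.up.{u} k)) ρ)) ∈
        M.eval P (Fin.cons (code (ULift.up.{u} (k + 1))) ρ))
    (ht : M.eval t ρ = M.eval t' ρ ∧ M.eval t ρ ∈ M.eval .nat ρ) :
    M.eval (.natElim P z s t) ρ = M.eval (.natElim P' z' s' t') ρ := by
  obtain ⟨k, hk⟩ := M.mem_nat.1 ht.2
  have hmem : ∀ k : ℕ, (Nat.rec (M.eval z ρ) (fun j r => M.eval s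
      (Fin.cons r (Fin.cons (code (ULift.up.{u} j)) ρ))) k : ZFSet.{u}) ∈
      M.eval P (Fin.cons (code (ULift.up.{u} k)) ρ) := by
    intro k
    induction k with
    | zero => exact hz.2
    | succ k ih => exact (hs k _ ih).2
  simp only [eval, ← ht.1, ← hk, decode_code]
  clear hk
  induction k with
  | zero => exact hz.1
  | succ k ih => exact ((hs k _ (hmem k)).1).trans (by simp only [← ih])

/-- The environment in which the step case of trace elimination is evaluated. -/
noncomputable def stepEnv (ρ : Fin n → ZFSet.{u}) (t : Trace 𝒯) (x : Transition 𝒯) (r : ZFSet.{u}) :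
    Fin (n + 6) → ZFSet.{u} :=
  Fin.cons r (Fin.cons (code x) (Fin.cons (code x.tgt)
    (Fin.cons (code x.ev) (Fin.cons (code t) (Fin.cons (code x.src) ρ)))))

/-- The value of the motive of trace elimination at a trace. -/
noncomputable def motive (P : Tm 𝒯 (n + 2)) (ρ : Fin n → ZFSet.{u}) (t : Trace 𝒯) : ZFSet.{u} :=
  M.eval P (Fin.cons (code t) (Fin.cons (code t.tgt) ρ))

theorem eval_motiveAt_zero {P : Tm 𝒯 (n + 2)} {s τ : Tm 𝒯 n} {t : Trace 𝒯}
    (ht : code t = M.eval τ ρ) (hs : code t.tgt = M.eval s ρ) :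
    M.eval (Tm.motiveAt P 0 s τ) ρ = M.motive P ρ t := by
  rw [motive, ht, hs]
  exact M.eval_motiveAt P 0 s τ ρ

theorem eval_traceElim {P : Tm 𝒯 (n + 2)} {b τ : Tm 𝒯 n} {s : Tm 𝒯 (n + 6)} {t : Trace 𝒯}
    (ht : code t = M.eval τ ρ) :
    M.eval (.traceElim P b s τ) ρ = traceRec (𝒯 := 𝒯) (s₀ := t.src) (M.eval b ρ)
      (fun t x r => M.eval s (stepEnv ρ t x r)) (s := t.tgt) t.hom := by
  simp only [eval, ← ht, decode_code]
  rfl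

/-- The context of the step case of trace elimination. -/
abbrev stepCxt (Γ : Cxt 𝒯 n) (s₀ : Tm 𝒯 n) (P : Tm 𝒯 (n + 2)) : Cxt 𝒯 (n + 6) :=
  (((((Γ.cons .state).cons (.finTrace s₀.wk (.var 0))).cons .event).cons .state).cons
    (.step (.var 3) (.var 1) (.var 0))).cons (Tm.motiveAt P 5 (.var 4) (.var 3))

/-- A trace, a transition starting where it ends, and a value of the motive together form a point of
the context of the step case. This links the premise of the eliminator to recursion on paths. -/
theorem forall_stepCxt {Γ : Cxt 𝒯 n} {s₀ : Tm 𝒯 n} {P : Tm 𝒯 (n + 2)}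
    {Q : (Fin (n + 6) → ZFSet.{u}) → Prop} (h : M.Forall (stepCxt Γ s₀ P) Q) (γ : M.ctx Γ)
    {t : Trace 𝒯} {x : Transition 𝒯} (hx : t.tgt = x.src)
    (ht : code t.src = M.eval s₀ (M.env Γ γ)) {r : ZFSet.{u}} (hr : r ∈ M.motive P (M.env Γ γ) t) :
    Q (stepEnv (M.env Γ γ) t x r) := by
  simp only [stepCxt, forall_cons] at h
  refine h γ (code x.src) (M.mem_state.2 ⟨_, rfl⟩) (code t) ?_ (code x.ev)
    (M.mem_event.2 ⟨_, rfl⟩) (code x.tgt) (M.mem_state.2 ⟨_, rfl⟩) (code x)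
    (M.mem_step.2 ⟨x, ⟨rfl, rfl, rfl⟩, rfl⟩) r ?_
  · refine M.mem_finTrace.2 ⟨t, ⟨?_, ?_⟩, rfl⟩
    · rw [ht, eval_wk]
    · rw [hx]
      rfl
  · rw [motive, hx] at hr
    rw [eval_motiveAt]
    exact hr

theorem eval_step_motive {P : Tm 𝒯 (n + 2)} {t : Trace 𝒯} {x : Transition 𝒯}
    (hx : t.tgt = x.src) (r : ZFSet.{u}) :
    M.eval (Tm.motiveAt P 6 (.var 2) (.tstep (.var 4) (.var 3) (.var 1))) (stepEnv ρ t x r) =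
      M.motive P ρ (t.snoc x hx) := by
  rw [eval_motiveAt, M.eval_tstep (t := t) (x := x) rfl rfl hx]
  rfl

theorem traceElim_mem {P : Tm 𝒯 (n + 2)} {b τ s₀ s₁ : Tm 𝒯 n} {s : Tm 𝒯 (n + 6)}
    (hb : M.eval b ρ ∈ M.eval (Tm.motiveAt P 0 s₀ (.tnil s₀)) ρ)
    (hs : ∀ (t : Trace 𝒯) (x : Transition 𝒯) (h : t.tgt = x.src), code t.src = M.eval s₀ ρ →
      ∀ r ∈ M.motive P ρ t, M.eval s (stepEnv ρ t x r) ∈ M.motive P ρ (t.snoc x h))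
    (hτ : M.eval τ ρ ∈ M.eval (.finTrace s₀ s₁) ρ) :
    M.eval (.traceElim P b s τ) ρ ∈ M.eval (Tm.motiveAt P 0 s₁ τ) ρ := by
  obtain ⟨t, ⟨ht₀, ht₁⟩, ht⟩ := M.mem_finTrace.1 hτ
  -- The recursion starts at the actual source of `t`, whose code is the value of `s₀`.
  rw [M.eval_motiveAt_zero (t := Trace.empty t.src) (M.eval_tnil ht₀).symm ht₀] at hb
  rw [M.eval_traceElim ht, M.eval_motiveAt_zero ht ht₁]
  exact traceRec_mem (M.motive P ρ) hb
    (fun t' x h ht' r hr => hs t' x h (ht' ▸ ht₀) r hr) t.hom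

theorem traceElim_congr {P P' : Tm 𝒯 (n + 2)} {b b' τ τ' s₀ s₁ : Tm 𝒯 n} {s s' : Tm 𝒯 (n + 6)}
    (hb : M.eval b ρ = M.eval b' ρ ∧ M.eval b ρ ∈ M.eval (Tm.motiveAt P 0 s₀ (.tnil s₀)) ρ)
    (hs : ∀ (t : Trace 𝒯) (x : Transition 𝒯) (h : t.tgt = x.src), code t.src = M.eval s₀ ρ →
      ∀ r ∈ M.motive P ρ t, M.eval s (stepEnv ρ t x r) = M.eval s' (stepEnv ρ t x r) ∧
        M.eval s (stepEnv ρ t x r) ∈ M.motive P ρ (t.snoc x h))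
    (hτ : M.eval τ ρ = M.eval τ' ρ ∧ M.eval τ ρ ∈ M.eval (.finTrace s₀ s₁) ρ) :
    M.eval (.traceElim P b s τ) ρ = M.eval (.traceElim P' b' s' τ') ρ := by
  obtain ⟨t, ⟨ht₀, ht₁⟩, ht⟩ := M.mem_finTrace.1 hτ.2
  have hb₂ := hb.2
  rw [M.eval_motiveAt_zero (t := Trace.empty t.src) (M.eval_tnil ht₀).symm ht₀] at hb₂
  rw [M.eval_traceElim ht, M.eval_traceElim (ht.trans hτ.1), ← hb.1]
  exact traceRec_congr (M.motive P ρ) hb₂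
    (fun t' x h ht' r hr => hs t' x h (ht' ▸ ht₀) r hr) t.hom

theorem exists_corec {X a : Tm 𝒯 n} {h e x : Tm 𝒯 (n + 1)}
    (hh : ∀ y ∈ M.eval X ρ, M.eval h (Fin.cons y ρ) ∈ M.eval .state (Fin.cons y ρ : Fin (n + 1) → _))
    (he : ∀ y ∈ M.eval X ρ, M.eval e (Fin.cons y ρ) ∈ M.eval .event (Fin.cons y ρ : Fin (n + 1) → _))
    (hx : ∀ y ∈ M.eval X ρ, M.eval x (Fin.cons y ρ) ∈ M.eval X.wk (Fin.cons y ρ))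
    (ha : M.eval a ρ ∈ M.eval X ρ) :
    ∃ w : InfTrace 𝒯, (∀ k : ℕ,
      code (w k).1 = M.eval h (Fin.cons ((fun y => M.eval x (Fin.cons y ρ))^[k] (M.eval a ρ)) ρ) ∧
      code (w k).2 = M.eval e (Fin.cons ((fun y => M.eval x (Fin.cons y ρ))^[k] (M.eval a ρ)) ρ)) ∧
      code w = M.eval (.corec h e x a) ρ := by
  obtain ⟨w, hw⟩ := exists_infTrace (𝒯 := 𝒯) (X := M.eval X ρ)
    (h := fun y => M.eval h (Fin.cons y ρ)) (e := fun y => M.eval e (Fin.cons y ρ))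
    (x := fun y => M.eval x (Fin.cons y ρ)) (fun y hy => M.mem_state.1 (hh y hy))
    (fun y hy => M.mem_event.1 (he y hy)) (fun y hy => M.eval_wk X y ρ ▸ hx y hy) ha
  refine ⟨w, hw, ?_⟩
  simp only [eval]
  exact (corecSet_eq w hw).symm

/-- The two iterations coincide because the seed lies in `X` and `x` preserves `X`, on which all
components agree. -/
theorem corec_congr {X a a' : Tm 𝒯 n} {h h' e e' x x' : Tm 𝒯 (n + 1)}
    (hh : ∀ y ∈ M.eval X ρ, M.eval h (Fin.cons y ρ) = M.eval h' (Fin.cons y ρ))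
    (he : ∀ y ∈ M.eval X ρ, M.eval e (Fin.cons y ρ) = M.eval e' (Fin.cons y ρ))
    (hx : ∀ y ∈ M.eval X ρ, M.eval x (Fin.cons y ρ) = M.eval x' (Fin.cons y ρ) ∧
      M.eval x (Fin.cons y ρ) ∈ M.eval X.wk (Fin.cons y ρ))
    (ha : M.eval a ρ = M.eval a' ρ ∧ M.eval a ρ ∈ M.eval X ρ) :
    M.eval (.corec h e x a) ρ = M.eval (.corec h' e' x' a') ρ := by
  have hk := iterate_eq_of_eqOn (X := M.eval X ρ) (x := fun y => M.eval x (Fin.cons y ρ))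
    (x' := fun y => M.eval x' (Fin.cons y ρ)) (fun y hy => M.eval_wk X y ρ ▸ (hx y hy).2)
    (fun y hy => (hx y hy).1) ha.2
  simp only [eval]
  refine corecSet_congr fun k => ?_
  rw [← ha.1, ← (hk k).2]
  exact ⟨hh _ (hk k).1, he _ (hk k).1⟩

end Model

/-! ### Sizes at the levels of the universe hierarchies -/

namespace IsHierarchy

variable {κ : ℕ → Cardinal.{u}}

theorem zero_le (h : IsHierarchy 𝒯 N κ) : ∀ i : ℕ, (i : ℕ∞) ≤ N → κ 0 ≤ κ i
  | 0, _ => le_rfl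
  | i + 1, hi => (h.zero_le i (le_trans (by exact_mod_cast Nat.le_succ i) hi)).trans
      (h.lt_succ i hi).le

theorem smallSystem (h : IsHierarchy 𝒯 N κ) {i : ℕ} (hi : (i : ℕ∞) ≤ N) :
    SmallSystem 𝒯 (κ i) where
  inaccessible := h.inaccessible i hi
  state_lt := h.state_lt.trans_le (h.zero_le i hi)
  event_lt := h.event_lt.trans_le (h.zero_le i hi)
  step_lt s e s' := (h.step_lt s e s').trans_le (h.zero_le i hi)

end IsHierarchy

namespace Model

variable {M : Model 𝒯}

/-- The cardinal whose stage of the cumulative hierarchy interprets a universe. -/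
def univCard (M : Model 𝒯) : Univ → Cardinal.{u}
  | .uc i => M.ucCard i
  | .ty i => M.tyCard i

theorem eval_univ (U : Univ) {n : ℕ} (ρ : Fin n → ZFSet.{u}) :
    M.eval (Univ.tm U) ρ = ZFSet.vonNeumann (M.univCard U).ord := by
  cases U <;> rfl

theorem IsAdmissible.univCard_inaccessible (hM : M.IsAdmissible N ℓ) {U : Univ}
    (hU : (U.level : ℕ∞) ≤ N) : (M.univCard U).IsInaccessible := by
  cases U with
  | uc i => exact hM.uc.inaccessible i hU
  | ty i => exact hM.ty.inaccessible i hU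

/-- Knowledge types are cut out of the codes of all elements of the presheaf, so the total space
must be small. This follows from smallness of the fibres and of the set of traces, by regularity. -/
theorem IsAdmissible.elements_lt (hM : M.IsAdmissible N ℓ) (hℓ : (ℓ : ℕ∞) ≤ N) :
    #M.K.Elements < M.tyCard ℓ := by
  have h := hM.ty.smallSystem hℓ
  refine mk_sigma_lt (β := fun t : (Trace 𝒯)ᵒᵖ => M.K.obj t) h.inaccessible ?_ fun t => hM.K_lt t.unop
  rw [← mk_congr (equivToOpposite (α := Trace 𝒯))]
  exact h.trace_lt

/-! ## Denotations of traces, extensions and restrictions -/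

section Denotation

variable {n : ℕ} {ρ : Fin n → ZFSet.{u}}

/-- The end of the trace and the source of the transition are both coded by the value of `s₁`;
injectivity of codes makes them composable. -/
theorem exists_step {τ e π s₀ s₁ s₂ : Tm 𝒯 n} (hτ : M.eval τ ρ ∈ M.eval (.finTrace s₀ s₁) ρ)
    (hπ : M.eval π ρ ∈ M.eval (.step s₁ e s₂) ρ) :
    ∃ (t : Trace 𝒯) (x : Transition 𝒯) (_ : t.tgt = x.src), code t = M.eval τ ρ ∧
      code t.src = M.eval s₀ ρ ∧ code t.tgt = M.eval s₁ ρ ∧ code x = M.eval π ρ ∧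
      code x.ev = M.eval e ρ ∧ code x.tgt = M.eval s₂ ρ := by
  obtain ⟨t, ⟨h₀, h₁⟩, ht⟩ := M.mem_finTrace.1 hτ
  obtain ⟨x, ⟨h₂, h₃, h₄⟩, hx⟩ := M.mem_step.1 hπ
  exact ⟨t, x, code_injective (h₁.trans h₂.symm), ht, h₀, h₁, hx, h₃, h₄⟩

theorem exists_ext {τ τ' : Tm 𝒯 n} {z : ZFSet.{u}} (hz : z ∈ M.eval (.ext τ τ') ρ) :
    ∃ (t t' : Trace 𝒯) (f : t ⟶ t'), code t = M.eval τ ρ ∧ code t' = M.eval τ' ρ ∧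
      code (Arrow.mk f) = z := by
  obtain ⟨f, ⟨h₁, h₂⟩, hf⟩ := M.mem_ext.1 hz
  exact ⟨f.left, f.right, f.hom, h₁, h₂, hf⟩

theorem exists_extComp {τ τ' τ'' ε ε' : Tm 𝒯 n} (hε : M.eval ε ρ ∈ M.eval (.ext τ τ') ρ)
    (hε' : M.eval ε' ρ ∈ M.eval (.ext τ' τ'') ρ) :
    ∃ (t t' t'' : Trace 𝒯) (f : t ⟶ t') (g : t' ⟶ t''), code t = M.eval τ ρ ∧
      code t'' = M.eval τ'' ρ ∧ code (Arrow.mk f) = M.eval ε ρ ∧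
      code (Arrow.mk g) = M.eval ε' ρ ∧
      code (Arrow.mk (f ≫ g)) = M.eval (.extComp ε ε') ρ := by
  obtain ⟨t, t', f, h₁, h₂, hf⟩ := exists_ext hε
  obtain ⟨u, u', g, h₃, h₄, hg⟩ := exists_ext hε'
  obtain rfl : t' = u := code_injective (h₂.trans h₃.symm)
  refine ⟨t, t', u', f, g, h₁, h₄, hf, hg, ?_⟩
  rw [M.eval_extComp hf hg rfl]
  simp

theorem eval_restrict_mk {ε k : Tm 𝒯 n} {t t' : Trace 𝒯} {f : t ⟶ t'} {y : M.K.obj (op t')}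
    (hf : code (Arrow.mk f) = M.eval ε ρ) (hy : code (M.K.elementsMk (op t') y) = M.eval k ρ) :
    M.eval (.restrict ε k) ρ = code (M.K.elementsMk (op t) (M.K.map f.op y)) := by
  rw [M.eval_restrict hf hy rfl]
  simp

/-- Codes are those of elements of the total space; injectivity of the code of the base trace places
the element in the fibre over the given `t`. -/
theorem exists_know {τ : Tm 𝒯 n} {t : Trace 𝒯} {z : ZFSet.{u}} (ht : code t = M.eval τ ρ)
    (hz : z ∈ M.eval (.know τ) ρ) :
    ∃ y : M.K.obj (op t), code (M.K.elementsMk (op t) y) = z := by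
  obtain ⟨⟨⟨t'⟩, y⟩, h, hy⟩ := M.mem_know.1 hz
  obtain rfl : t = t' := code_injective (ht.trans h.symm)
  exact ⟨y, hy⟩

theorem exists_restrict {τ τ' ε k : Tm 𝒯 n} (hε : M.eval ε ρ ∈ M.eval (.ext τ τ') ρ)
    (hk : M.eval k ρ ∈ M.eval (.know τ') ρ) :
    ∃ (t t' : Trace 𝒯) (f : t ⟶ t') (y : M.K.obj (op t')), M.eval τ ρ = code t ∧
      M.eval τ' ρ = code t' ∧ M.eval ε ρ = code (Arrow.mk f) ∧
      M.eval k ρ = code (M.K.elementsMk (op t') y) ∧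
      M.eval (.restrict ε k) ρ = code (M.K.elementsMk (op t) (M.K.map f.op y)) := by
  obtain ⟨t, t', f, h₁, h₂, hf⟩ := exists_ext hε
  obtain ⟨y, hy⟩ := exists_know h₂ hk
  exact ⟨t, t', f, y, h₁.symm, h₂.symm, hf.symm, hy.symm, eval_restrict_mk hf hy⟩

theorem restrict_mem {τ τ' ε k : Tm 𝒯 n} (hε : M.eval ε ρ ∈ M.eval (.ext τ τ') ρ)
    (hk : M.eval k ρ ∈ M.eval (.know τ') ρ) :
    M.eval (.restrict ε k) ρ ∈ M.eval (.know τ) ρ := by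
  obtain ⟨t, t', f, y, h₁, -, -, -, h⟩ := exists_restrict hε hk
  rw [h]
  exact M.mem_know.2 ⟨_, h₁.symm, rfl⟩

theorem restrict_extId {τ k : Tm 𝒯 n} {s₀ s₁ : Tm 𝒯 n}
    (hτ : M.eval τ ρ ∈ M.eval (.finTrace s₀ s₁) ρ) (hk : M.eval k ρ ∈ M.eval (.know τ) ρ) :
    M.eval (.restrict (.extId τ) k) ρ = M.eval k ρ := by
  obtain ⟨t, -, ht⟩ := M.mem_finTrace.1 hτ
  obtain ⟨y, hy⟩ := exists_know ht hk
  rw [eval_restrict_mk (M.eval_extId ht).symm hy, ← hy]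
  simp

theorem restrict_extComp {τ τ' τ'' ε ε' k : Tm 𝒯 n} (hε : M.eval ε ρ ∈ M.eval (.ext τ τ') ρ)
    (hε' : M.eval ε' ρ ∈ M.eval (.ext τ' τ'') ρ) (hk : M.eval k ρ ∈ M.eval (.know τ'') ρ) :
    M.eval (.restrict (.extComp ε ε') k) ρ = M.eval (.restrict ε (.restrict ε' k)) ρ := by
  obtain ⟨t, t', t'', f, g, -, h, hf, hg, hfg⟩ := exists_extComp hε hε'
  obtain ⟨y, hy⟩ := exists_know h hk
  rw [eval_restrict_mk hfg hy, eval_restrict_mk hf (eval_restrict_mk hg hy).symm]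
  simp

theorem eval_head {t : Tm 𝒯 n} {w : InfTrace 𝒯} (h : code w = M.eval t ρ) :
    M.eval (.head t) ρ = code (w 0).1 := by
  simp only [eval, ← h, decode_code]

theorem eval_tail {t : Tm 𝒯 n} {w : InfTrace 𝒯} (h : code w = M.eval t ρ) :
    M.eval (.tail t) ρ = ZFSet.pair (code (w 0).2) (code fun k => w (k + 1)) := by
  simp only [eval, ← h, decode_code]

theorem tail_mem {t : Tm 𝒯 n} (ht : M.eval t ρ ∈ M.eval .infTrace ρ) :
    M.eval (.tail t) ρ ∈ M.eval (.prod .event .infTrace) ρ := by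
  obtain ⟨w, hw⟩ := M.mem_infTrace.1 ht
  rw [eval_tail hw]
  exact ZFSet.pair_mem_prod.2 ⟨M.mem_event.2 ⟨_, rfl⟩, M.mem_infTrace.2 ⟨_, rfl⟩⟩

end Denotation

/-! ## Soundness -/

/-- The validity of a judgment in the model. -/
def Valid (M : Model 𝒯) : Judgment 𝒯 → Prop
  | .ctx _ => True
  | .typ Γ t A => M.Forall Γ fun ρ => M.eval t ρ ∈ M.eval A ρ
  | .eq Γ t t' A => M.Forall Γ fun ρ => M.eval t ρ = M.eval t' ρ ∧ M.eval t ρ ∈ M.eval A ρ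

/-! ### Valid judgments over extended contexts -/

section Valid

variable {n : ℕ} {Γ : Cxt 𝒯 n}

theorem Valid.mem {t A : Tm 𝒯 n} (h : M.Valid (.typ Γ t A)) (γ : M.ctx Γ) :
    M.eval t (M.env Γ γ) ∈ M.eval A (M.env Γ γ) := h γ

theorem Valid.eq {t t' A : Tm 𝒯 n} (h : M.Valid (.eq Γ t t' A)) (γ : M.ctx Γ) :
    M.eval t (M.env Γ γ) = M.eval t' (M.env Γ γ) ∧
      M.eval t (M.env Γ γ) ∈ M.eval A (M.env Γ γ) := h γ

theorem Valid.mem_cons {C : Tm 𝒯 n} {t A : Tm 𝒯 (n + 1)} (h : M.Valid (.typ (Γ.cons C) t A))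
    (γ : M.ctx Γ) : ∀ x ∈ M.eval C (M.env Γ γ),
      M.eval t (Fin.cons x (M.env Γ γ)) ∈ M.eval A (Fin.cons x (M.env Γ γ)) :=
  (M.forall_cons (Q := fun ρ => M.eval t ρ ∈ M.eval A ρ)).1 h γ

theorem Valid.eq_cons {C : Tm 𝒯 n} {t t' A : Tm 𝒯 (n + 1)}
    (h : M.Valid (.eq (Γ.cons C) t t' A)) (γ : M.ctx Γ) : ∀ x ∈ M.eval C (M.env Γ γ),
      M.eval t (Fin.cons x (M.env Γ γ)) = M.eval t' (Fin.cons x (M.env Γ γ)) ∧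
        M.eval t (Fin.cons x (M.env Γ γ)) ∈ M.eval A (Fin.cons x (M.env Γ γ)) :=
  (M.forall_cons (Q := fun ρ => M.eval t ρ = M.eval t' ρ ∧ M.eval t ρ ∈ M.eval A ρ)).1 h γ

theorem eval_succ_motive (P : Tm 𝒯 (n + 1)) (r : ZFSet.{u}) (k : ℕ) (ρ : Fin n → ZFSet.{u}) :
    M.eval (P.subst (Fin.cons (Tm.succ (.var 1)) fun i => .var (i.addNat 2)) : Tm 𝒯 (n + 2))
      (Fin.cons r (Fin.cons (code (ULift.up.{u} k)) ρ)) =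
    M.eval P (Fin.cons (code (ULift.up.{u} (k + 1))) ρ) := by
  rw [eval_subst, eval_cons, M.eval_succ (k := k) rfl]
  rfl

theorem forall_natStepCxt {P : Tm 𝒯 (n + 1)} {Q : (Fin (n + 2) → ZFSet.{u}) → Prop}
    (h : M.Forall ((Γ.cons .nat).cons P) Q) (γ : M.ctx Γ) (k : ℕ) {r : ZFSet.{u}}
    (hr : r ∈ M.eval P (Fin.cons (code (ULift.up.{u} k)) (M.env Γ γ))) :
    Q (Fin.cons r (Fin.cons (code (ULift.up.{u} k)) (M.env Γ γ))) := by
  simp only [forall_cons] at h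
  exact h γ _ (M.mem_nat.2 ⟨k, rfl⟩) r hr

theorem Valid.mem_natStep {P : Tm 𝒯 (n + 1)} {s : Tm 𝒯 (n + 2)}
    (h : M.Valid (.typ ((Γ.cons .nat).cons P) s
      (P.subst (Fin.cons (Tm.succ (.var 1)) fun i => .var (i.addNat 2))))) (γ : M.ctx Γ) (k : ℕ) :
    ∀ r ∈ M.eval P (Fin.cons (code (ULift.up.{u} k)) (M.env Γ γ)),
      M.eval s (Fin.cons r (Fin.cons (code (ULift.up.{u} k)) (M.env Γ γ))) ∈
        M.eval P (Fin.cons (code (ULift.up.{u} (k + 1))) (M.env Γ γ)) := by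
  intro r hr
  rw [← eval_succ_motive P r k]
  exact forall_natStepCxt (Q := fun ρ => M.eval s ρ ∈ M.eval (P.subst (Fin.cons (Tm.succ (.var 1)) fun i => .var (i.addNat 2))) ρ)
    h γ k hr

theorem Valid.eq_natStep {P : Tm 𝒯 (n + 1)} {s s' : Tm 𝒯 (n + 2)}
    (h : M.Valid (.eq ((Γ.cons .nat).cons P) s s'
      (P.subst (Fin.cons (Tm.succ (.var 1)) fun i => .var (i.addNat 2))))) (γ : M.ctx Γ) (k : ℕ) :
    ∀ r ∈ M.eval P (Fin.cons (code (ULift.up.{u} k)) (M.env Γ γ)),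
      M.eval s (Fin.cons r (Fin.cons (code (ULift.up.{u} k)) (M.env Γ γ))) =
        M.eval s' (Fin.cons r (Fin.cons (code (ULift.up.{u} k)) (M.env Γ γ))) ∧
      M.eval s (Fin.cons r (Fin.cons (code (ULift.up.{u} k)) (M.env Γ γ))) ∈
        M.eval P (Fin.cons (code (ULift.up.{u} (k + 1))) (M.env Γ γ)) := by
  intro r hr
  rw [← eval_succ_motive P r k]
  exact forall_natStepCxt (Q := fun ρ => M.eval s ρ = M.eval s' ρ ∧
    M.eval s ρ ∈ M.eval (P.subst (Fin.cons (Tm.succ (.var 1)) fun i => .var (i.addNat 2))) ρ)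
    h γ k hr

theorem Valid.mem_traceStep {s₀ : Tm 𝒯 n} {P : Tm 𝒯 (n + 2)} {s : Tm 𝒯 (n + 6)}
    (h : M.Valid (.typ (stepCxt Γ s₀ P) s
      (Tm.motiveAt P 6 (.var 2) (.tstep (.var 4) (.var 3) (.var 1))))) (γ : M.ctx Γ)
    (t : Trace 𝒯) (x : Transition 𝒯) (hx : t.tgt = x.src)
    (ht : code t.src = M.eval s₀ (M.env Γ γ)) :
    ∀ r ∈ M.motive P (M.env Γ γ) t, M.eval s (stepEnv (M.env Γ γ) t x r) ∈
      M.motive P (M.env Γ γ) (t.snoc x hx) := by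
  intro r hr
  rw [← M.eval_step_motive hx r]
  exact M.forall_stepCxt (Q := fun ρ => M.eval s ρ ∈ M.eval (Tm.motiveAt P 6 (.var 2) (.tstep (.var 4) (.var 3) (.var 1))) ρ)
    h γ hx ht hr

theorem Valid.eq_traceStep {s₀ : Tm 𝒯 n} {P : Tm 𝒯 (n + 2)} {s s' : Tm 𝒯 (n + 6)}
    (h : M.Valid (.eq (stepCxt Γ s₀ P) s s'
      (Tm.motiveAt P 6 (.var 2) (.tstep (.var 4) (.var 3) (.var 1))))) (γ : M.ctx Γ)
    (t : Trace 𝒯) (x : Transition 𝒯) (hx : t.tgt = x.src)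
    (ht : code t.src = M.eval s₀ (M.env Γ γ)) :
    ∀ r ∈ M.motive P (M.env Γ γ) t,
      M.eval s (stepEnv (M.env Γ γ) t x r) = M.eval s' (stepEnv (M.env Γ γ) t x r) ∧
      M.eval s (stepEnv (M.env Γ γ) t x r) ∈ M.motive P (M.env Γ γ) (t.snoc x hx) := by
  intro r hr
  rw [← M.eval_step_motive hx r]
  exact M.forall_stepCxt (Q := fun ρ => M.eval s ρ = M.eval s' ρ ∧
    M.eval s ρ ∈ M.eval (Tm.motiveAt P 6 (.var 2) (.tstep (.var 4) (.var 3) (.var 1))) ρ)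
    h γ hx ht hr

end Valid

/-- Formation rules are size estimates, introduction and elimination rules are membership
statements, and computation rules are equations between the set-theoretic operations. For equations,
membership of the left side is enough, since the right side has the same value. -/
theorem valid_of_derivable (hM : M.IsAdmissible N ℓ) (hℓ : (ℓ : ℕ∞) ≤ N) {J : Judgment 𝒯}
    (h : Derivable 𝒯 N ℓ J) : M.Valid J := by
  -- The base types of the computational layer all live in the lowest universe of their hierarchy.
  have hS : SmallSystem 𝒯 (M.ucCard 0) := hM.uc.smallSystem zero_le
  induction h with
  | ctxEmpty | ctxExt => trivial
  | var i => exact fun γ => M.env_mem _ γ i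
  | conv _ _ ih₁ ih₂ =>
    intro γ
    rw [← (ih₂.eq γ).1]
    exact ih₁ γ
  | eqRefl _ ih => exact fun γ => ⟨rfl, ih γ⟩
  | eqSymm _ ih => exact fun γ => ⟨(ih γ).1.symm, (ih γ).1 ▸ (ih γ).2⟩
  | eqTrans _ _ ih₁ ih₂ => exact fun γ => ⟨(ih₁ γ).1.trans (ih₂ γ).1, (ih₁ γ).2⟩
  | eqConv _ _ ih₁ ih₂ => exact fun γ => ⟨(ih₁.eq γ).1, (ih₂.eq γ).1 ▸ (ih₁.eq γ).2⟩
  | ucForm i hi =>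
    intro γ
    simpa only [eval, ZFSet.vonNeumann_mem_vonNeumann_iff, ord_lt_ord] using hM.uc.lt_succ i hi
  | tyForm i hi =>
    intro γ
    simpa only [eval, ZFSet.vonNeumann_mem_vonNeumann_iff, ord_lt_ord] using hM.ty.lt_succ i hi
  | propForm =>
    intro γ
    -- Propositions belong to the other hierarchy, so smallness is measured by its first cardinal.
    have h := hM.ty.smallSystem (i := 0) zero_le
    exact codeSet_mem_vonNeumann h.inaccessible h.truth_lt _
  | piForm hU _ _ ihA ihB =>
    intro γ
    have hB := ihB.mem_cons γ
    have hA := ihA γ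
    simp only [eval_univ] at hA hB ⊢
    exact piSet_mem_vonNeumann (hM.univCard_inaccessible hU) hA hB
  | piIntro _ ih => exact fun γ => lamSet_mem_piSet (ih.mem_cons γ)
  | piElim _ _ ihf iha =>
    intro γ
    rw [eval_subst_inst]
    exact appSet_mem (ihf γ) (iha γ)
  | @piBeta _ Γ a A b _ _ _ iha ihb =>
    intro γ
    have h : M.eval (.app (.lam A b) a) (M.env Γ γ) = M.eval b (Fin.cons (M.eval a _) _) :=
      appSet_lamSet (fun x => M.eval b (Fin.cons x (M.env Γ γ))) (iha γ)
    change M.eval _ _ = M.eval _ _ ∧ M.eval _ _ ∈ M.eval _ _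
    rw [eval_subst_inst, eval_subst_inst]
    exact ⟨h, h ▸ ihb.mem_cons γ _ (iha γ)⟩
  | piCong hU _ _ ihA ihB =>
    intro γ
    have hB := ihB.eq_cons γ
    have hA := ihA γ
    simp only [eval_univ] at hA hB ⊢
    refine ⟨?_, piSet_mem_vonNeumann (hM.univCard_inaccessible hU) hA.2 fun x hx => (hB x hx).2⟩
    simp only [eval, ← hA.1]
    exact piSet_congr fun x hx => (hB x hx).1
  | lamCong _ _ ihA iht =>
    intro γ
    have ht := iht.eq_cons γ
    refine ⟨?_, lamSet_mem_piSet fun x hx => (ht x hx).2⟩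
    -- Both graphs have the same domain, and the bodies need to agree only there.
    simp only [eval, ← (ihA γ).1]
    exact lamSet_congr fun x hx => (ht x hx).1
  | appCong _ _ ihf iha =>
    intro γ
    rw [eval_subst_inst]
    refine ⟨?_, appSet_mem (ihf γ).2 (iha γ).2⟩
    simp only [eval, (ihf γ).1, (iha γ).1]
  | prodForm hU _ _ ihA ihB =>
    intro γ
    have hA := ihA γ
    have hB := ihB γ
    simp only [eval_univ] at hA hB ⊢
    exact prod_mem_vonNeumann (hM.univCard_inaccessible hU) hA hB
  | prodIntro _ _ iha ihb => exact fun γ => ZFSet.pair_mem_prod.2 ⟨iha γ, ihb γ⟩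
  | prodFst _ ih =>
    intro γ
    obtain ⟨a, ha, b, hb, h⟩ := ZFSet.mem_prod.1 (ih γ)
    simpa only [eval, h, fstSet_pair] using ha
  | prodSnd _ ih =>
    intro γ
    obtain ⟨a, ha, b, hb, h⟩ := ZFSet.mem_prod.1 (ih γ)
    simpa only [eval, h, sndSet_pair] using hb
  | fstBeta _ _ iha ihb =>
    intro γ
    simpa only [eval, fstSet_pair, true_and] using iha γ
  | sndBeta _ _ iha ihb =>
    intro γ
    simpa only [eval, sndSet_pair, true_and] using ihb γ
  | prodCong hU _ _ ihA ihB =>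
    intro γ
    have hA := ihA γ
    have hB := ihB γ
    simp only [eval_univ] at hA hB ⊢
    refine ⟨?_, prod_mem_vonNeumann (hM.univCard_inaccessible hU) hA.2 hB.2⟩
    simp only [eval, hA.1, hB.1]
  | pairCong _ _ iha ihb =>
    intro γ
    refine ⟨?_, ZFSet.pair_mem_prod.2 ⟨(iha γ).2, (ihb γ).2⟩⟩
    simp only [eval, (iha γ).1, (ihb γ).1]
  | fstCong _ ih =>
    intro γ
    obtain ⟨a, ha, b, hb, h⟩ := ZFSet.mem_prod.1 (ih γ).2
    simpa only [eval, ← (ih γ).1, h, fstSet_pair, true_and] using ha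
  | sndCong _ ih =>
    intro γ
    obtain ⟨a, ha, b, hb, h⟩ := ZFSet.mem_prod.1 (ih γ).2
    simpa only [eval, ← (ih γ).1, h, sndSet_pair, true_and] using hb
  | natForm => exact fun γ => codeSet_mem_vonNeumann hS.inaccessible hS.nat_lt _
  | natZero => exact fun γ => M.mem_nat.2 ⟨0, rfl⟩
  | natSucc _ ih =>
    intro γ
    obtain ⟨k, hk⟩ := M.mem_nat.1 (ih γ)
    exact M.mem_nat.2 ⟨k + 1, (M.eval_succ hk).symm⟩
  | natElim _ _ _ _ _ ihz ihs iht =>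
    intro γ
    have hz := ihz.mem γ
    change M.eval _ _ ∈ M.eval _ _
    rw [eval_subst_inst] at hz ⊢
    exact M.natElim_mem hz (ihs.mem_natStep γ) (iht γ)
  | @natElimZero _ Γ P z s _ _ _ _ _ ihz _ =>
    intro γ
    have h : M.eval (.natElim P z s .zero) (M.env Γ γ) = M.eval z (M.env Γ γ) := by
      simp only [eval, decode_code]
      rfl
    exact ⟨h, h ▸ ihz.mem γ⟩
  | natElimSucc _ _ _ _ _ ihz ihs iht =>
    intro γ
    have hz := ihz.mem γ
    obtain ⟨k, hk⟩ := M.mem_nat.1 (iht.mem γ)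
    change M.eval _ _ = M.eval _ _ ∧ M.eval _ _ ∈ M.eval _ _
    rw [eval_subst_inst] at hz ⊢
    refine ⟨?_, M.natElim_mem hz (ihs.mem_natStep γ) (M.mem_nat.2 ⟨k + 1, (M.eval_succ hk).symm⟩)⟩
    rw [eval_subst, eval_cons, eval_inst]
    simp only [eval, ← hk, decode_code]
  | succCong _ ih =>
    intro γ
    obtain ⟨k, hk⟩ := M.mem_nat.1 (ih.eq γ).2
    refine ⟨?_, M.mem_nat.2 ⟨k + 1, (M.eval_succ hk).symm⟩⟩
    simp only [eval, (ih.eq γ).1]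
  | natElimCong _ _ _ _ _ ihz ihs iht =>
    intro γ
    have hz := ihz.eq γ
    change M.eval _ _ = M.eval _ _ ∧ M.eval _ _ ∈ M.eval _ _
    rw [eval_subst_inst] at hz ⊢
    exact ⟨M.natElim_congr hz (ihs.eq_natStep γ) (iht.eq γ),
      M.natElim_mem hz.2 (fun k r hr => (ihs.eq_natStep γ k r hr).2) (iht.eq γ).2⟩
  | stateForm => exact fun γ => codeSet_mem_vonNeumann hS.inaccessible hS.state_lt _
  | eventForm => exact fun γ => codeSet_mem_vonNeumann hS.inaccessible hS.event_lt _
  | stepForm => exact fun γ => codeSet_mem_vonNeumann hS.inaccessible hS.transition_lt _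
  | stateConst s => exact fun γ => M.mem_state.2 ⟨s, rfl⟩
  | eventConst e => exact fun γ => M.mem_event.2 ⟨e, rfl⟩
  | stepConst x => exact fun γ => M.mem_step.2 ⟨x, ⟨rfl, rfl, rfl⟩, rfl⟩
  | stepCong _ _ _ ih₁ ih₂ ih₃ =>
    intro γ
    refine ⟨?_, codeSet_mem_vonNeumann hS.inaccessible hS.transition_lt _⟩
    simp only [eval, (ih₁.eq γ).1, (ih₂.eq γ).1, (ih₃.eq γ).1]
  | finTraceForm => exact fun γ => codeSet_mem_vonNeumann hS.inaccessible hS.trace_lt _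
  | traceNil _ ih =>
    intro γ
    obtain ⟨s, hs⟩ := M.mem_state.1 (ih γ)
    exact M.mem_finTrace.2 ⟨_, ⟨hs, hs⟩, (M.eval_tnil hs).symm⟩
  | traceStep _ _ _ ih₁ _ ih₃ =>
    intro γ
    obtain ⟨t, x, h, ht, hs₀, -, hx, -, hs₂⟩ := exists_step (ih₁.mem γ) (ih₃.mem γ)
    exact M.mem_finTrace.2 ⟨t.snoc x h, ⟨hs₀, hs₂⟩, (M.eval_tstep ht hx h).symm⟩
  | traceElim _ _ _ _ _ _ _ ihb ihs ihτ =>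
    exact fun γ => M.traceElim_mem (ihb.mem γ) (ihs.mem_traceStep γ) (ihτ.mem γ)
  | @traceElimNil _ Γ P b c s₀ _ _ _ _ _ ih₀ _ ihb _ =>
    intro γ
    obtain ⟨s, hs⟩ := M.mem_state.1 (ih₀.mem γ)
    have h : M.eval (.traceElim P b c (.tnil s₀)) (M.env Γ γ) = M.eval b (M.env Γ γ) :=
      M.eval_traceElim (M.eval_tnil hs).symm
    exact ⟨h, h ▸ ihb.mem γ⟩
  | @traceElimStep _ Γ _ _ _ _ _ _ τ e π _ _ _ _ _ _ _ _ _ _ ihb ihs ihτ _ ihπ =>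
    intro γ
    obtain ⟨t, x, h, ht, hs₀, hs₁, hx, he, hs₂⟩ := exists_step (ihτ.mem γ) (ihπ.mem γ)
    rw [h] at hs₁
    have ht' : code (t.snoc x h) = M.eval (.tstep τ e π) (M.env Γ γ) :=
      (M.eval_tstep ht hx h).symm
    refine ⟨?_, M.traceElim_mem (ihb.mem γ) (ihs.mem_traceStep γ)
      (M.mem_finTrace.2 ⟨t.snoc x h, ⟨hs₀, hs₂⟩, ht'⟩)⟩
    -- The six substituted terms evaluate to the entries of `stepEnv`: the recursive value and the
    -- codes of the transition, its target, its event, the shorter trace and its end state.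
    rw [M.eval_traceElim ht', traceRec_snoc, eval_subst, eval_cons, eval_cons, eval_cons,
      eval_cons, eval_cons, eval_inst, M.eval_traceElim ht, ← ht, ← hs₁, ← hx, ← he, ← hs₂]
    rfl
  | finTraceCong _ _ ih₁ ih₂ =>
    intro γ
    refine ⟨?_, codeSet_mem_vonNeumann hS.inaccessible hS.trace_lt _⟩
    simp only [eval, (ih₁.eq γ).1, (ih₂.eq γ).1]
  | tnilCong _ ih =>
    intro γ
    obtain ⟨s, hs⟩ := M.mem_state.1 (ih.eq γ).2
    refine ⟨?_, M.mem_finTrace.2 ⟨_, ⟨hs, hs⟩, (M.eval_tnil hs).symm⟩⟩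
    simp only [eval, (ih.eq γ).1]
  | tstepCong _ _ _ ih₁ _ ih₃ =>
    intro γ
    obtain ⟨t, x, h, ht, hs₀, -, hx, -, hs₂⟩ := exists_step (ih₁.eq γ).2 (ih₃.eq γ).2
    refine ⟨?_, M.mem_finTrace.2 ⟨t.snoc x h, ⟨hs₀, hs₂⟩, (M.eval_tstep ht hx h).symm⟩⟩
    simp only [eval, (ih₁.eq γ).1, (ih₃.eq γ).1]
  | traceElimCong _ _ _ _ _ _ _ ihb ihs ihτ =>
    intro γ
    exact ⟨M.traceElim_congr (ihb.eq γ) (ihs.eq_traceStep γ) (ihτ.eq γ),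
      M.traceElim_mem (ihb.eq γ).2 (fun t x h ht r hr => (ihs.eq_traceStep γ t x h ht r hr).2)
        (ihτ.eq γ).2⟩
  | infTraceForm => exact fun γ => codeSet_mem_vonNeumann hS.inaccessible hS.infTrace_lt _
  | infHead _ ih =>
    intro γ
    obtain ⟨w, hw⟩ := M.mem_infTrace.1 (ih γ)
    refine M.mem_state.2 ⟨(w 0).1, ?_⟩
    simp only [eval, ← hw, decode_code]
  | infTail _ ih => exact fun γ => tail_mem (ih γ)
  | infCorec _ _ _ _ _ _ ihh ihe ihx iha =>
    intro γ
    obtain ⟨w, -, hw⟩ := M.exists_corec (ihh.mem_cons γ) (ihe.mem_cons γ) (ihx.mem_cons γ)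
      (iha.mem γ)
    exact M.mem_infTrace.2 ⟨w, hw⟩
  | headCorec _ _ _ _ _ _ ihh ihe ihx iha =>
    intro γ
    obtain ⟨w, hk, hw⟩ := M.exists_corec (ihh.mem_cons γ) (ihe.mem_cons γ) (ihx.mem_cons γ)
      (iha.mem γ)
    have h := eval_head hw
    refine ⟨?_, M.mem_state.2 ⟨_, h.symm⟩⟩
    rw [h, eval_subst_inst]
    exact (hk 0).1
  | tailCorec _ _ _ _ _ _ ihh ihe ihx iha =>
    intro γ
    obtain ⟨w, hk, hw⟩ := M.exists_corec (ihh.mem_cons γ) (ihe.mem_cons γ) (ihx.mem_cons γ)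
      (iha.mem γ)
    refine ⟨?_, tail_mem (M.mem_infTrace.2 ⟨w, hw⟩)⟩
    rw [eval_tail hw]
    simp only [eval, eval_subst_inst]
    -- Iterating `k` times from the next seed is by definition iterating `k + 1` times from the
    -- original one, so the shifted trace solves the unfolding equations for the next seed.
    rw [corecSet_eq (fun k => w (k + 1)) fun k => hk (k + 1), (hk 0).2]
    rfl
  | headCong _ ih =>
    intro γ
    obtain ⟨w, hw⟩ := M.mem_infTrace.1 (ih.eq γ).2
    refine ⟨?_, M.mem_state.2 ⟨_, (eval_head hw).symm⟩⟩
    simp only [eval, (ih.eq γ).1]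
  | tailCong _ ih =>
    intro γ
    refine ⟨?_, tail_mem (ih.eq γ).2⟩
    simp only [eval, (ih.eq γ).1]
  | corecCong _ _ _ _ _ _ ihh ihe ihx iha =>
    intro γ
    obtain ⟨w, -, hw⟩ := M.exists_corec (fun y hy => (ihh.eq_cons γ y hy).2)
      (fun y hy => (ihe.eq_cons γ y hy).2) (fun y hy => (ihx.eq_cons γ y hy).2) (iha.eq γ).2
    exact ⟨M.corec_congr (fun y hy => (ihh.eq_cons γ y hy).1) (fun y hy => (ihe.eq_cons γ y hy).1)
      (ihx.eq_cons γ) (iha.eq γ), M.mem_infTrace.2 ⟨w, hw⟩⟩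
  | extForm => exact fun γ => codeSet_mem_vonNeumann hS.inaccessible hS.arrow_lt _
  | extId _ ih =>
    intro γ
    obtain ⟨t, -, ht⟩ := M.mem_finTrace.1 (ih γ)
    exact M.mem_ext.2 ⟨_, ⟨ht, ht⟩, (M.eval_extId ht).symm⟩
  | extComp _ _ ih₁ ih₂ =>
    intro γ
    obtain ⟨t, t', t'', f, g, ht, ht'', -, -, h⟩ := exists_extComp (ih₁.mem γ) (ih₂.mem γ)
    exact M.mem_ext.2 ⟨_, ⟨ht, ht''⟩, h⟩
  | extStep _ _ _ ih₁ _ ih₃ =>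
    intro γ
    obtain ⟨t, x, h, ht, -, -, hx, -, -⟩ := exists_step (ih₁.mem γ) (ih₃.mem γ)
    exact M.mem_ext.2 ⟨_, ⟨ht, (M.eval_tstep ht hx h).symm⟩, (M.eval_extStep ht hx h).symm⟩
  | extCong _ _ ih₁ ih₂ =>
    intro γ
    refine ⟨?_, codeSet_mem_vonNeumann hS.inaccessible hS.arrow_lt _⟩
    simp only [eval, (ih₁.eq γ).1, (ih₂.eq γ).1]
  | extIdCong _ ih =>
    intro γ
    obtain ⟨t, -, ht⟩ := M.mem_finTrace.1 (ih.eq γ).2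
    refine ⟨?_, M.mem_ext.2 ⟨_, ⟨ht, ht⟩, (M.eval_extId ht).symm⟩⟩
    simp only [eval, (ih.eq γ).1]
  | extCompCong _ _ ih₁ ih₂ =>
    intro γ
    obtain ⟨t, t', t'', f, g, ht, ht'', -, -, h⟩ := exists_extComp (ih₁.eq γ).2 (ih₂.eq γ).2
    refine ⟨?_, M.mem_ext.2 ⟨_, ⟨ht, ht''⟩, h⟩⟩
    simp only [eval, (ih₁.eq γ).1, (ih₂.eq γ).1]
  | extStepCong _ _ _ ih₁ _ ih₃ =>
    intro γ
    obtain ⟨t, x, h, ht, -, -, hx, -, -⟩ := exists_step (ih₁.eq γ).2 (ih₃.eq γ).2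
    refine ⟨?_, M.mem_ext.2
      ⟨_, ⟨ht, (M.eval_tstep ht hx h).symm⟩, (M.eval_extStep ht hx h).symm⟩⟩
    simp only [eval, (ih₁.eq γ).1, (ih₃.eq γ).1]
  | knowForm =>
    exact fun γ => codeSet_mem_vonNeumann (hM.ty.inaccessible ℓ hℓ) (hM.elements_lt hℓ) _
  | restrict _ _ ih₁ ih₂ => exact fun γ => restrict_mem (ih₁.mem γ) (ih₂.mem γ)
  | restrictId _ _ ih₁ ih₂ =>
    intro γ
    have h := restrict_extId (ih₁.mem γ) (ih₂.mem γ)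
    exact ⟨h, h ▸ ih₂.mem γ⟩
  | restrictComp _ _ _ ih₁ ih₂ ih₃ =>
    intro γ
    have h := restrict_extComp (ih₁.mem γ) (ih₂.mem γ) (ih₃.mem γ)
    exact ⟨h, h ▸ restrict_mem (ih₁.mem γ) (restrict_mem (ih₂.mem γ) (ih₃.mem γ))⟩
  | knowCong _ ih =>
    intro γ
    refine ⟨?_, codeSet_mem_vonNeumann (hM.ty.inaccessible ℓ hℓ) (hM.elements_lt hℓ) _⟩
    simp only [eval, (ih.eq γ).1]
  | restrictCong _ _ ih₁ ih₂ =>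
    intro γ
    refine ⟨?_, restrict_mem (ih₁.eq γ).2 (ih₂.eq γ).2⟩
    simp only [eval, (ih₁.eq γ).1, (ih₂.eq γ).1]

end Model

namespace Model

variable {M : Model 𝒯}

/-! ## Interpretation of judgments and substitutions -/

/-- A substituted type and the reindexed type are equal but not definitionally so; terms over them
are compared by their underlying sets. -/
theorem setCwF_tm_heq {X : setCwF.{u}.Ctx} {A A' : setCwF.{u}.Ty X} (hA : A = A')
    {a : setCwF.Tm X A} {a' : setCwF.Tm X A'} (h : ∀ x : X, (a x).1 = (a' x).1) : a ≍ a' := by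
  subst hA
  exact heq_of_eq (funext fun x => Subtype.ext (h x))

theorem existsUnique_interprets {n : ℕ} {Γ : Cxt 𝒯 n} {t A : Tm 𝒯 n}
    (h : M.Valid (.typ Γ t A)) :
    ∃! a : setCwF.Tm (M.ctx Γ) (M.type Γ A), M.Interprets Γ t A a :=
  ⟨fun γ => ⟨M.eval t (M.env Γ γ), h γ⟩, fun _ => rfl,
    fun _ h' => funext fun γ => Subtype.ext (h' γ)⟩

variable {m n : ℕ} {Δ : Cxt 𝒯 m} {σ : Fin n → Tm 𝒯 m} {Γ : Cxt 𝒯 n}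

theorem InterpretsSubst.env_eq {f : M.ctx Δ ⟶ M.ctx Γ} (hf : M.InterpretsSubst Δ σ Γ f)
    (δ : M.ctx Δ) : M.env Γ (setFun f δ) = fun i => M.eval (σ i) (M.env Δ δ) :=
  funext (hf δ)

theorem InterpretsSubst.eval_subst {f : M.ctx Δ ⟶ M.ctx Γ} (hf : M.InterpretsSubst Δ σ Γ f)
    (t : Tm 𝒯 n) (δ : M.ctx Δ) :
    M.eval (t.subst σ) (M.env Δ δ) = M.eval t (M.env Γ (setFun f δ)) := by
  rw [Model.eval_subst, hf.env_eq]

theorem InterpretsSubst.unique {f f' : M.ctx Δ ⟶ M.ctx Γ} (hf : M.InterpretsSubst Δ σ Γ f)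
    (hf' : M.InterpretsSubst Δ σ Γ f') : f' = f := by
  refine ConcreteCategory.hom_ext (C := Type (u + 1)) (X := M.ctx Δ) (Y := M.ctx Γ) f' f fun δ => ?_
  exact M.env_injective Γ ((hf'.env_eq δ).trans (hf.env_eq δ).symm)

theorem InterpretsSubst.type_subst {f : M.ctx Δ ⟶ M.ctx Γ} (hf : M.InterpretsSubst Δ σ Γ f)
    (A : Tm 𝒯 n) : M.type Δ (A.subst σ) = setCwF.tySub f (M.type Γ A) :=
  funext (hf.eval_subst A)

theorem InterpretsSubst.exists_interprets {f : M.ctx Δ ⟶ M.ctx Γ}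
    (hf : M.InterpretsSubst Δ σ Γ f) {t A : Tm 𝒯 n} {a : setCwF.Tm (M.ctx Γ) (M.type Γ A)}
    (ha : M.Interprets Γ t A a) :
    ∃ a' : setCwF.Tm (M.ctx Δ) (M.type Δ (A.subst σ)),
      M.Interprets Δ (t.subst σ) (A.subst σ) a' ∧ a' ≍ setCwF.tmSub f a := by
  have hmem : ∀ δ : M.ctx Δ, (a (setFun f δ)).1 ∈ M.type Δ (A.subst σ) δ := fun δ => by
    rw [hf.type_subst A]
    exact (a (setFun f δ)).2
  refine ⟨fun δ => ⟨(a (setFun f δ)).1, hmem δ⟩, fun δ => ?_,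
    setCwF_tm_heq (hf.type_subst A) fun _ => rfl⟩
  rw [hf.eval_subst]
  exact ha (setFun f δ)

/-- By `Model.eval_subst`, validity of the components says that their values form a well-typed
assignment for `Γ`, hence come from a point. -/
theorem exists_interpretsSubst (h : ∀ i, M.Valid (.typ Δ (σ i) ((Γ.lookup i).subst σ))) :
    ∃ f : M.ctx Δ ⟶ M.ctx Γ, M.InterpretsSubst Δ σ Γ f := by
  have H : ∀ δ : M.ctx Δ, ∃ γ : M.ctx Γ, M.env Γ γ = fun i => M.eval (σ i) (M.env Δ δ) :=
    fun δ => M.exists_env_eq Γ _ fun i => by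
      rw [← Model.eval_subst]
      exact (h i).mem δ
  choose f hf using H
  exact ⟨TypeCat.ofHom f, fun δ i => congrFun (hf δ) i⟩

theorem interpretsSubst_inst {A s : Tm 𝒯 n} {a : setCwF.Tm (M.ctx Γ) (M.type Γ A)}
    (ha : M.Interprets Γ s A a) :
    M.InterpretsSubst Γ (Tm.inst s) (Γ.cons A)
      (setCwF.pair (𝟙 (M.ctx Γ)) (A := M.type Γ A) a) := by
  intro γ i
  refine Fin.cases ?_ (fun i => ?_) i
  · exact ha γ
  · rfl

end Model

end DEKL

/-! ### The soundness theorem -/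

theorem mainTheorem6 (𝒯 : TransitionSystem.{u}) (N : ℕ∞) (ℓ : ℕ) (hℓ : (ℓ : ℕ∞) ≤ N)
    (M : Model 𝒯) (hM : M.IsAdmissible N ℓ) :
    -- contexts are interpreted by the empty context and by comprehension
    (M.ctx (.nil : Cxt 𝒯 0) = setCwF.empty ∧
      ∀ {n : ℕ} (Γ : Cxt 𝒯 n) (A : Tm 𝒯 n),
        M.ctx (Γ.cons A) = setCwF.ext (M.ctx Γ) (M.type Γ A)) ∧
    -- every derivable typing judgment has a (unique) interpretation
    (∀ {n : ℕ} (Γ : Cxt 𝒯 n) (t A : Tm 𝒯 n), Derivable 𝒯 N ℓ (.typ Γ t A) →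
      ∃! a : setCwF.Tm (M.ctx Γ) (M.type Γ A), M.Interprets Γ t A a) ∧
    -- derivable equality judgments, in particular all computation rules, hold in the model
    (∀ {n : ℕ} (Γ : Cxt 𝒯 n) (t t' A : Tm 𝒯 n), Derivable 𝒯 N ℓ (.eq Γ t t' A) →
      ∃ a : setCwF.Tm (M.ctx Γ) (M.type Γ A),
        M.Interprets Γ t A a ∧ M.Interprets Γ t' A a) ∧
    (∀ {n : ℕ} (Γ : Cxt 𝒯 n) (A B : Tm 𝒯 n) (U : Univ), Derivable 𝒯 N ℓ (.eq Γ A B U.tm) →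
      M.type Γ A = M.type Γ B) ∧
    -- a simultaneous substitution is interpreted by a unique context morphism, and the
    -- interpretations of types and terms commute with substitution
    (∀ {m n : ℕ} (Δ : Cxt 𝒯 m) (σ : Fin n → Tm 𝒯 m) (Γ : Cxt 𝒯 n),
      SubstDerivable 𝒯 N ℓ Δ σ Γ →
      ∃ f : M.ctx Δ ⟶ M.ctx Γ, M.InterpretsSubst Δ σ Γ f ∧
        (∀ f' : M.ctx Δ ⟶ M.ctx Γ, M.InterpretsSubst Δ σ Γ f' → f' = f) ∧
        (∀ A : Tm 𝒯 n, M.type Δ (A.subst σ) = setCwF.tySub f (M.type Γ A)) ∧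
        ∀ (t A : Tm 𝒯 n) (a : setCwF.Tm (M.ctx Γ) (M.type Γ A)),
          Derivable 𝒯 N ℓ (.typ Γ t A) → M.Interprets Γ t A a →
          ∃ a' : setCwF.Tm (M.ctx Δ) (M.type Δ (A.subst σ)),
            M.Interprets Δ (t.subst σ) (A.subst σ) a' ∧ a' ≍ setCwF.tmSub f a) ∧
    -- identities and composites of substitutions are interpreted by identities and composites
    (∀ {n : ℕ} (Γ : Cxt 𝒯 n), M.InterpretsSubst Γ Tm.var Γ (𝟙 (M.ctx Γ))) ∧
    (∀ {k m n : ℕ} (Θ : Cxt 𝒯 k) (τ : Fin m → Tm 𝒯 k) (Δ : Cxt 𝒯 m) (σ : Fin n → Tm 𝒯 m)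
      (Γ : Cxt 𝒯 n) (g : M.ctx Θ ⟶ M.ctx Δ) (f : M.ctx Δ ⟶ M.ctx Γ),
      M.InterpretsSubst Θ τ Δ g → M.InterpretsSubst Δ σ Γ f →
      M.InterpretsSubst Θ (fun i => (σ i).subst τ) Γ (g ≫ f)) ∧
    -- weakening is interpreted by the comprehension projection
    (∀ {n : ℕ} (Γ : Cxt 𝒯 n) (A : Tm 𝒯 n),
      M.InterpretsSubst (Γ.cons A) (fun i => .var i.succ) Γ (setCwF.p (M.type Γ A))) ∧
    -- substitution of one term: `⟦t[s/x]⟧ = ⟦t⟧[⟨id, ⟦s⟧⟩]`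
    (∀ {n : ℕ} (Γ : Cxt 𝒯 n) (A s : Tm 𝒯 n) (t B : Tm 𝒯 (n + 1)),
      Derivable 𝒯 N ℓ (.typ (Γ.cons A) t B) → Derivable 𝒯 N ℓ (.typ Γ s A) →
      ∀ (a : setCwF.Tm (M.ctx Γ) (M.type Γ A))
        (b : setCwF.Tm (M.ctx (Γ.cons A)) (M.type (Γ.cons A) B)),
        M.Interprets Γ s A a → M.Interprets (Γ.cons A) t B b →
        ∃ c : setCwF.Tm (M.ctx Γ) (M.type Γ (B.subst (Tm.inst s))),
          M.Interprets Γ (t.subst (Tm.inst s)) (B.subst (Tm.inst s)) c ∧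
          c ≍ setCwF.tmSub (Γ := M.ctx (Γ.cons A))
            (setCwF.pair (𝟙 (M.ctx Γ)) (A := M.type Γ A) a) b) ∧
    -- derivable traces denote morphisms of the free trace category: `nil` the identities, and
    -- `step` the composition with a generating transition
    (∀ {n : ℕ} (Γ : Cxt 𝒯 n) (τ σ₀ σ₁ : Tm 𝒯 n),
      Derivable 𝒯 N ℓ (.typ Γ τ (.finTrace σ₀ σ₁)) → ∀ γ : M.ctx Γ,
      ∃ (s₀ s₁ : 𝒯.State) (m : pt s₀ ⟶ pt s₁),
        M.eval σ₀ (M.env Γ γ) = code s₀ ∧ M.eval σ₁ (M.env Γ γ) = code s₁ ∧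
        M.eval τ (M.env Γ γ) = code (Trace.mk s₀ s₁ m)) ∧
    (∀ {n : ℕ} (Γ : Cxt 𝒯 n) (σ : Tm 𝒯 n),
      Derivable 𝒯 N ℓ (.typ Γ σ .state) → ∀ γ : M.ctx Γ,
      ∃ s : 𝒯.State, M.eval σ (M.env Γ γ) = code s ∧
        M.eval (.tnil σ) (M.env Γ γ) = code (Trace.mk s s (𝟙 (pt s)))) ∧
    (∀ {n : ℕ} (Γ : Cxt 𝒯 n) (τ e π σ₀ σ₁ σ₂ : Tm 𝒯 n),
      Derivable 𝒯 N ℓ (.typ Γ τ (.finTrace σ₀ σ₁)) → Derivable 𝒯 N ℓ (.typ Γ e .event) →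
      Derivable 𝒯 N ℓ (.typ Γ π (.step σ₁ e σ₂)) → ∀ γ : M.ctx Γ,
      ∃ (s₀ s₁ s₂ : 𝒯.State) (m : pt s₀ ⟶ pt s₁) (a : 𝒯.Event) (x : 𝒯.Step s₁ a s₂),
        M.eval τ (M.env Γ γ) = code (Trace.mk s₀ s₁ m) ∧
        M.eval e (M.env Γ γ) = code a ∧
        M.eval π (M.env Γ γ) = code (Transition.mk s₁ a s₂ x) ∧
        M.eval (.tstep τ e π) (M.env Γ γ) = code (Trace.mk s₀ s₂ (m ≫ gen a x))) ∧
    -- restriction denotes the action of the knowledge presheaf on extension morphisms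
    (∀ {n : ℕ} (Γ : Cxt 𝒯 n) (τ τ' ε k : Tm 𝒯 n),
      Derivable 𝒯 N ℓ (.typ Γ ε (.ext τ τ')) → Derivable 𝒯 N ℓ (.typ Γ k (.know τ')) →
      ∀ γ : M.ctx Γ, ∃ (t t' : Trace 𝒯) (f : t ⟶ t') (y : M.K.obj (op t')),
        M.eval τ (M.env Γ γ) = code t ∧ M.eval τ' (M.env Γ γ) = code t' ∧
        M.eval ε (M.env Γ γ) = code (Arrow.mk f) ∧
        M.eval k (M.env Γ γ) = code (M.K.elementsMk (op t') y) ∧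
        M.eval (.restrict ε k) (M.env Γ γ) =
          code (M.K.elementsMk (op t) (M.K.map f.op y))) := by
  have hV : ∀ {J : Judgment 𝒯}, Derivable 𝒯 N ℓ J → M.Valid J :=
    Model.valid_of_derivable hM hℓ
  refine ⟨⟨rfl, fun _ _ => rfl⟩, fun Γ t A h => Model.existsUnique_interprets (hV h),
    -- The section defined by the left term also interprets the right one, because the values agree
    -- pointwise.
    fun Γ t t' A h => ⟨fun γ => ⟨M.eval t (M.env Γ γ), ((hV h).eq γ).2⟩, fun _ => rfl,
      fun γ => ((hV h).eq γ).1⟩,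
    fun Γ A B U h => funext fun γ => ((hV h).eq γ).1, ?_, fun _ _ _ => rfl, ?_, fun _ _ _ _ => rfl,
    ?_, ?_, ?_, ?_, ?_⟩
  · intro m n Δ σ Γ h
    obtain ⟨f, hf⟩ := Model.exists_interpretsSubst fun i => hV (h.2 i)
    exact ⟨f, hf, fun f' => hf.unique, hf.type_subst, fun t A a _ => hf.exists_interprets⟩
  · intro k m n Θ τ Δ σ Γ g f hg hf θ i
    rw [hg.eval_subst]
    exact hf (setFun g θ) i
  · intro n Γ A s t B _ _ a b ha hb
    -- Instantiating the last variable is the simultaneous substitution interpreted by pairing the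
    -- identity with `a`.
    exact (Model.interpretsSubst_inst ha).exists_interprets hb
  · intro n Γ τ σ₀ σ₁ h γ
    obtain ⟨t, ⟨h₀, h₁⟩, ht⟩ := M.mem_finTrace.1 ((hV h).mem γ)
    exact ⟨t.src, t.tgt, t.hom, h₀.symm, h₁.symm, ht.symm⟩
  · intro n Γ σ h γ
    obtain ⟨s, hs⟩ := M.mem_state.1 ((hV h).mem γ)
    exact ⟨s, hs.symm, M.eval_tnil hs⟩
  · intro n Γ τ e π σ₀ σ₁ σ₂ hτ _ hπ γ
    obtain ⟨⟨s₀, s₁, m⟩, ⟨s, a, s₂, x⟩, h, ht, -, -, hx, he, -⟩ :=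
      Model.exists_step ((hV hτ).mem γ) ((hV hπ).mem γ)
    -- With the states identified, the transport in `snoc` becomes an identity and a plain composite
    -- remains.
    obtain rfl : s₁ = s := h
    refine ⟨s₀, s₁, s₂, m, a, x, ht.symm, he.symm, hx.symm, ?_⟩
    rw [M.eval_tstep ht hx rfl]
    simp [Trace.snoc]
  · intro n Γ τ τ' ε k hε hk γ
    exact Model.exists_restrict ((hV hε).mem γ) ((hV hk).mem γ)
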